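/- **Theorem C.** A holomorphic map $\phi:\mathbb P^2\to\mathbb P^2$ of degree $d$ (over $\mathbb C$) is a map given in homogeneous coordinates by three homogeneous polynomials of degree $d$ without common zero in $\mathbb C^3\setminus\{0\}$. A foliation $\mathcal F$ on $\mathbb P^2$ is given by a $1$-form $\omega=A\,dx+B\,dy+C\,dz$ on $\mathbb C^3$, unique up to a nonzero constant factor, where $A,B,C$ are homogeneous polynomials of the same degree with $xA+yB+zC=0$ and with only finitely many common zeros in $\mathbb P^2$; a rational $1$-form induces $\mathcal F$ if it is a nonzero rational multiple of $\omega$. The map $\phi$ preserves $\mathcal F$ if $\phi^*\omega=h\,\omega$ for some nonzero polynomial $h$ (where $\phi^*$ is the pull-back by a homogeneous polynomial lift of $\phi$ to $\mathbb C^3$). The degree $\deg\mathcal F$ is the number of tangencies between $\mathcal F$ and a generic line. Suppose that $\phi:\mathbb P^2\to\mathbb P^2$ is a holomorphic map of degree $d\ge 2$ preserving a foliation $\mathcal F$. Then $\deg\mathcal F\in\{0,1\}$ and, in appropriate homogeneous coordinates $[x:y:z]$ on $\mathbb P^2$, one of the following holds: 1. $\mathcal F$ is the pencil of lines induced by $d(x/y)$,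 and $\phi=[P(x,y):Q(x,y):R(x,y,z)]$ with $P,Q,R$ homogeneous polynomials of degree $d$; 2. $\mathcal F$ is induced by $d\log(x^{\lambda}yz^{-1-\lambda})$ with $\lambda\in\mathbb C\setminus\mathbb Q$, and $\phi=[x^d:y^d:z^d]$; 3. $\mathcal F$ is induced by $d\log(x^{\xi}yz^{-1-\xi})$ with $\xi$ a primitive third root of unity, and $\phi=[z^d:x^d:y^d]$; 4. $\mathcal F$ is induced by $d(x^py^q/z^{p+q})$ with integers $p,q\ge1$, $\gcd(p,q)=1$, and $\phi=[x^d:y^d:R(x,y,z)]$ with $R=z^{\delta}\prod_{i=1}^{l}(z^{p+q}+c_ix^py^q)$, where $\delta,l\ge0$ are integers with $d=\delta+l(p+q)$ and $c_i\in\mathbb C^*$; 5. $\mathcal F$ is induced by $d\log(xyz^{-2})$, and $\phi=[y^d:x^d:R(x,y,z)]$ with $R=z^{\delta}\prod_{i=1}^{l}(z^2+c_ixy)$, where $\delta,l\ge0$ are integers with $d=\delta+2l$ and $c_i\in\mathbb C^*$. -/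

import Mathlib

open scoped LinearAlgebra.Projectivization

noncomputable section

namespace FoliatedPlane

/-- The complex projective plane, with homogeneous coordinates `x = X 0`, `y = X 1`, `z = X 2`. -/
abbrev P2 : Type := ℙ ℂ (Fin 3 → ℂ)

abbrev Poly : Type := MvPolynomial (Fin 3) ℂ

/-- The polynomial 1-form `A 0 dx + A 1 dy + A 2 dz` on `ℂ³`, given by its coefficients. -/
abbrev OneForm : Type := Fin 3 → Poly

/-- The polynomial map `ℂ³ → ℂ³` with components `P`. -/
def evalMap (P : Fin 3 → Poly) (v : Fin 3 → ℂ) : Fin 3 → ℂ := fun i => MvPolynomial.eval v (P i)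

/-- `φ = [P 0 : P 1 : P 2]` at every point of the plane; in particular the `P i` have no common
zero except the origin. -/
def IsGivenBy (φ : P2 → P2) (P : Fin 3 → Poly) : Prop :=
  ∀ (v : Fin 3 → ℂ) (hv : v ≠ 0), ∃ hw : evalMap P v ≠ 0,
    φ (Projectivization.mk ℂ v hv) = Projectivization.mk ℂ (evalMap P v) hw

/-- `φ` is a holomorphic self-map of the plane of degree `d`: it is given in homogeneous
coordinates by three homogeneous polynomials of degree `d` without common zero. -/
def IsHolomorphicOfDegree (φ : P2 → P2) (d : ℕ) : Prop :=
  ∃ P : Fin 3 → Poly, (∀ i, (P i).IsHomogeneous d) ∧ IsGivenBy φ P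

/-- The pull-back `P^* A` of the 1-form `A` by the polynomial map `P`. -/
def pullback (P : Fin 3 → Poly) (A : OneForm) : OneForm :=
  fun j => ∑ i, MvPolynomial.bind₁ P (A i) * MvPolynomial.pderiv j (P i)

/-- A singular holomorphic foliation of the plane: a section with isolated zeroes of
`Ω¹ ⊗ 𝒪(n + 1)`, that is, a 1-form on `ℂ³` with homogeneous coefficients of degree `n`,
annihilated by the radial vector field, with finitely many zeroes in the plane.
Two such forms are the same foliation iff they differ by a nonzero constant factor; every notion
below is insensitive to such a factor. -/
structure Foliation where
  n : ℕ
  form : OneForm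
  homogeneous : ∀ i, (form i).IsHomogeneous n
  radial : ∑ i, MvPolynomial.X i * form i = 0
  isolated : {p : P2 | evalMap form p.rep = 0}.Finite

/-- The 1-form `A`, which may vanish along curves, induces the foliation `F`: it is a nonzero
multiple of the 1-form with isolated zeroes that defines `F`. -/
def Induces (A : OneForm) (F : Foliation) : Prop :=
  ∃ h : Poly, h ≠ 0 ∧ ∀ i, A i = h * F.form i

/-- `G = φ^* F`. -/
def IsPullback (φ : P2 → P2) (F G : Foliation) : Prop :=
  ∃ (d : ℕ) (P : Fin 3 → Poly), (∀ i, (P i).IsHomogeneous d) ∧ IsGivenBy φ P ∧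
    Induces (pullback P F.form) G

/-- `φ` preserves `F`, that is, `φ^* F = F`. -/
def Preserves (φ : P2 → P2) (F : Foliation) : Prop := IsPullback φ F F

/-- The set of points of the line `m 0 x + m 1 y + m 2 z = 0` at which `F` is tangent to it, i.e.
the zeroes of the restriction to this line of the form defining `F`. -/
def tangencies (F : Foliation) (m : Fin 3 → ℂ) : Set P2 :=
  {p | m ⬝ᵥ p.rep = 0 ∧ ∀ w : Fin 3 → ℂ, m ⬝ᵥ w = 0 → evalMap F.form p.rep ⬝ᵥ w = 0}

/-- `F` has degree `k`: the number of tangencies of `F` with a generic line is `k`, where generic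
means that the line belongs to some nonempty Zariski open subset of the dual plane. -/
def HasDegree (F : Foliation) (k : ℕ) : Prop :=
  ∃ G : Poly, G ≠ 0 ∧ ∀ m : Fin 3 → ℂ, m ≠ 0 → MvPolynomial.eval m G ≠ 0 →
    (tangencies F m).encard = k

/-- The change of homogeneous coordinates `v ↦ M v`, as a map of the plane. -/
def coordMap (M : GL (Fin 3) ℂ) : P2 → P2 :=
  Projectivization.map (Matrix.toLin' (M : Matrix (Fin 3) (Fin 3) ℂ))
    (Matrix.mulVec_injective_of_isUnit M.isUnit)

/-- The new coordinates `M v` as linear forms in the old ones. -/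
def coordForms (M : GL (Fin 3) ℂ) : Fin 3 → Poly :=
  fun i => ∑ j, MvPolynomial.C (M i j) * MvPolynomial.X j

/-- In the homogeneous coordinates `M v`, the foliation `F` is induced by the 1-form `A` and
the map `φ` is equal to `[P 0 : P 1 : P 2]`. -/
def HasForm (F : Foliation) (φ : P2 → P2) (M : GL (Fin 3) ℂ) (A : OneForm)
    (P : Fin 3 → Poly) : Prop :=
  Induces (pullback (coordForms M) A) F ∧ IsGivenBy (coordMap M ∘ φ ∘ coordMap M⁻¹) P

/-- The 1-form `d (N / D)` multiplied by `D ^ 2`. -/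
def dQuot (N D : Poly) : OneForm :=
  fun i => D * MvPolynomial.pderiv i N - N * MvPolynomial.pderiv i D

/-- The 1-form `d log (x ^ a * y ^ b * z ^ c) = a dx / x + b dy / y + c dz / z` multiplied by
`x * y * z`. -/
def dLog (a b c : ℂ) : OneForm :=
  ![MvPolynomial.C a * (MvPolynomial.X 1 * MvPolynomial.X 2),
    MvPolynomial.C b * (MvPolynomial.X 0 * MvPolynomial.X 2),
    MvPolynomial.C c * (MvPolynomial.X 0 * MvPolynomial.X 1)]

/-- A polynomial in `x, y` seen as a polynomial in `x, y, z`. -/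
def ofXY (P : MvPolynomial (Fin 2) ℂ) : Poly := MvPolynomial.rename Fin.castSucc P

/-- `z ^ δ * ∏ i, (z ^ (p + q) + c i * x ^ p * y ^ q)`. -/
def fibredPoly (p q δ : ℕ) {l : ℕ} (c : Fin l → ℂ) : Poly :=
  MvPolynomial.X 2 ^ δ * ∏ i, (MvPolynomial.X 2 ^ (p + q) +
    MvPolynomial.C (c i) * (MvPolynomial.X 0 ^ p * MvPolynomial.X 1 ^ q))

end FoliatedPlane

end

open FoliatedPlane

/-! Let `P` lift the map, let `J` be its Jacobian matrix and `n` the degree of the coefficients of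
`ω`. Multiplying `(ω ∘ P) J = h ω` by the adjugate gives `det J • (ω ∘ P) = h • (ω adj J)`. The
coefficients of `ω ∘ P` have no common factor, since `P` is finite and `ω` has isolated zeros; hence
`h` divides `det J` (`dvd_det_jacobian`), which is nonzero of degree `3 (d - 1)`. As `h` has degree
`(d - 1) (n + 1)`, this forces `n ≤ 2`, and for `n = 2` it makes `det J` a constant multiple of `h`
(`invariant_form_degree`).

Moreover `ω = X ⨯₃ V` with `V` homogeneous of degree `n - 1`, and `n ≠ 0` (`exists_vectorField`). If
`n = 1`, then `V` is constant, the leaves are the lines through one point, and `P` respects this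
pencil (`exists_hasForm_pencil`).

If `n = 2`, then `V = L X` is linear and the two relations above combine into `J (L X) = a L P + b
P` with constants `a ≠ 0` and `b` (`exists_equivariance`). A Jordan block of `L` would give
polynomial integral curves, whose images under `P` are integral curves of too high degree for a
linear field in dimension three (`semisimple_of_equivariance`). So `L` is diagonalizable, with
distinct eigenvalues because singularities are isolated.

In eigencoordinates every monomial `u` of the component `i` satisfies `∑ u k * lam k = a * lam i +
b` (`weight_eq`). Each `X j ^ d` occurs in some component, so `d * lam j = a * lam (σ j) + b` for a
permutation `σ`. The normal forms correspond to the cycle type of `σ` and, for the identity, to the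
rationality of the ratio of eigenvalue differences. The weight equation determines the possible
monomials, and a diagonal change of coordinates normalizes the coefficients. -/

noncomputable section

namespace FoliatedPlane

open MvPolynomial

open scoped Matrix

/-! ### Homogeneous components and divisors of homogeneous polynomials -/

section Grading

variable {σ K : Type*} [Field K]

/-- The homomorphism sending a polynomial `f` to the polynomial `∑ fₖ Tᵏ` built from its
homogeneous components `fₖ`. -/
def gradingHom (σ K : Type*) [Field K] : MvPolynomial σ K →ₐ[K] Polynomial (MvPolynomial σ K) :=
  aeval fun i => Polynomial.C (X i) * Polynomial.X

theorem coeff_gradingHom (f : MvPolynomial σ K) (k : ℕ) :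
    (gradingHom σ K f).coeff k = homogeneousComponent k f := by
  induction f using MvPolynomial.induction_on' with
  | monomial u a =>
    have h1 : gradingHom σ K (monomial u a) =
        Polynomial.C (monomial u a) * Polynomial.X ^ u.degree := by
      rw [gradingHom, aeval_monomial]
      simp only [mul_pow, Finsupp.prod, Finset.prod_mul_distrib, Finset.prod_pow_eq_pow_sum]
      rw [monomial_eq, map_mul, Finsupp.prod, map_prod, Finsupp.degree_apply]
      simp only [map_pow, mul_assoc]
      rfl
    rw [h1, Polynomial.coeff_C_mul_X_pow]
    split_ifs with h
    · exact (homogeneousComponent_eq_self (isHomogeneous_monomial a h.symm)).symm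
    · rw [homogeneousComponent_of_mem (isHomogeneous_monomial a rfl), if_neg h]
  | add p q hp hq => simp [hp, hq]

theorem gradingHom_of_isHomogeneous {f : MvPolynomial σ K} {n : ℕ} (hf : f.IsHomogeneous n) :
    gradingHom σ K f = Polynomial.C f * Polynomial.X ^ n := by
  ext1 k
  rw [coeff_gradingHom, homogeneousComponent_of_mem hf, Polynomial.coeff_C_mul_X_pow]

theorem gradingHom_ne_zero {f : MvPolynomial σ K} (hf : f ≠ 0) : gradingHom σ K f ≠ 0 := by
  intro h
  apply hf
  rw [← sum_homogeneousComponent f]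
  exact Finset.sum_eq_zero fun i _ => by rw [← coeff_gradingHom, h, Polynomial.coeff_zero]

theorem homogeneousComponent_mul_of_isHomogeneous {p : MvPolynomial σ K} {e : ℕ}
    (hp : p.IsHomogeneous e) (g : MvPolynomial σ K) (n : ℕ) :
    homogeneousComponent n (g * p) = if e ≤ n then homogeneousComponent (n - e) g * p else 0 := by
  rw [← coeff_gradingHom, map_mul, gradingHom_of_isHomogeneous hp, ← mul_assoc,
    Polynomial.coeff_mul_X_pow']
  simp only [Polynomial.coeff_mul_C, coeff_gradingHom]

/-- Under `gradingHom` a homogeneous polynomial becomes a monomial in the grading variable. Degree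
and trailing degree are both additive over a domain, so they also coincide for each factor. -/
theorem isHomogeneous_of_dvd {f g : MvPolynomial σ K} {n : ℕ} (hg : g.IsHomogeneous n)
    (hg0 : g ≠ 0) (hfg : f ∣ g) : f.IsHomogeneous f.totalDegree := by
  obtain ⟨c, rfl⟩ := hfg
  have hf0 := left_ne_zero_of_mul hg0
  have hc0 := right_ne_zero_of_mul hg0
  have h := gradingHom_of_isHomogeneous hg
  rw [map_mul] at h
  have hF := gradingHom_ne_zero hf0
  have hC := gradingHom_ne_zero hc0
  have h1 := congrArg Polynomial.natDegree h
  have h2 := congrArg Polynomial.natTrailingDegree h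
  rw [Polynomial.natDegree_mul hF hC, Polynomial.natDegree_C_mul_X_pow _ _ hg0] at h1
  rw [Polynomial.natTrailingDegree_mul hF hC, Polynomial.natTrailingDegree_mul_X_pow
    (by simpa using hg0), Polynomial.natTrailingDegree_C] at h2
  have h3 := Polynomial.natTrailingDegree_le_natDegree (gradingHom σ K f)
  have h4 := Polynomial.natTrailingDegree_le_natDegree (gradingHom σ K c)
  have h5 : f.IsHomogeneous (gradingHom σ K f).natDegree := by
    have h6 : f = homogeneousComponent (gradingHom σ K f).natDegree f := by
      conv_lhs => rw [← sum_homogeneousComponent f]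
      by_cases hm : (gradingHom σ K f).natDegree ∈ Finset.range (f.totalDegree + 1)
      · refine Finset.sum_eq_single_of_mem _ hm fun k _ hk => ?_
        rw [← coeff_gradingHom]
        rcases lt_or_gt_of_ne hk with hk | hk
        · exact Polynomial.coeff_eq_zero_of_lt_natTrailingDegree (by omega)
        · exact Polynomial.coeff_eq_zero_of_natDegree_lt hk
      · exfalso
        apply hF
        rw [← Polynomial.leadingCoeff_eq_zero, Polynomial.leadingCoeff, coeff_gradingHom]
        exact homogeneousComponent_eq_zero _ _ (by simpa using hm)
    have h7 := homogeneousComponent_isHomogeneous (gradingHom σ K f).natDegree f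
    rwa [← h6] at h7
  rw [h5.totalDegree hf0]
  exact h5

end Grading

/-! ### Integrality and the Jacobian of a finite map -/

/-- Applying `D` to a relation `p(x) = 0` gives `p'(x) * D x = 0`, and `p'(x) ≠ 0` when `p` has
minimal degree. -/
theorem derivation_eq_zero_of_isIntegral {K R : Type*} [CommRing K] [CommRing R] [IsDomain R]
    [CharZero R] [Algebra K R] (S : Subalgebra K R) (D : Derivation K R R) (hD : ∀ s ∈ S, D s = 0)
    {x : R} (hx : IsIntegral S x) : D x = 0 := by
  classical
  have key : ∀ p : Polynomial S,
      D (Polynomial.aeval x p) = Polynomial.aeval x (Polynomial.derivative p) * D x := by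
    intro p
    induction p using Polynomial.induction_on' with
    | add p q hp hq => simp [hp, hq, add_mul]
    | monomial n a =>
      rw [Polynomial.aeval_monomial, Polynomial.derivative_monomial, Polynomial.aeval_monomial,
        D.leibniz, D.leibniz_pow, show algebraMap S R a = (a : R) from rfl, hD a a.2]
      simp only [smul_eq_mul, nsmul_eq_mul, map_mul, map_natCast, mul_zero, add_zero]
      simp only [show algebraMap S R a = (a : R) from rfl]
      ring
  -- Minimality is taken among all nonzero annihilating polynomials, not only monic ones, since the
  -- derivative of a monic polynomial need not be monic.
  have hex : ∃ n : ℕ, ∃ p : Polynomial S, p ≠ 0 ∧ Polynomial.aeval x p = 0 ∧ p.natDegree = n := by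
    obtain ⟨p, hp, h0⟩ := hx
    exact ⟨_, p, hp.ne_zero, by simpa [Polynomial.aeval_def] using h0, rfl⟩
  obtain ⟨p, hp, h0, hn⟩ := Nat.find_spec hex
  have h1 := key p
  rw [h0, map_zero] at h1
  rcases mul_eq_zero.1 h1.symm with h2 | h2
  · exfalso
    have hpos : p.natDegree ≠ 0 := by
      intro h
      rw [Polynomial.eq_C_of_natDegree_eq_zero h] at h0 hp
      simp only [Polynomial.aeval_C] at h0
      exact hp (by rw [Subtype.ext (a1 := p.coeff 0) (a2 := 0) h0, Polynomial.C_0])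
    have hlt := Polynomial.natDegree_derivative_lt hpos
    have hne : Polynomial.derivative p ≠ 0 := by
      intro h
      exact hpos (Polynomial.derivative_eq_zero.1 h)
    exact Nat.find_min hex (hn ▸ hlt) ⟨_, hne, h2, rfl⟩
  · exact h2

section Jacobian

variable {σ K : Type*} [Fintype σ] [Field K]

/-- The Jacobian matrix of a polynomial map. -/
def jacobian (P : σ → MvPolynomial σ K) : Matrix σ σ (MvPolynomial σ K) :=
  Matrix.of fun i j => pderiv j (P i)

/-- The polynomial ring is integral over the subalgebra generated by homogeneous polynomials of
positive degree whose only common zero is the origin. -/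
theorem isIntegral_of_no_common_zero [IsAlgClosed K] {P : σ → MvPolynomial σ K} {e : σ → ℕ}
    (he : ∀ i, 0 < e i) (hP : ∀ i, (P i).IsHomogeneous (e i))
    (h0 : ∀ v : σ → K, (∀ i, eval v (P i) = 0) → v = 0) (f : MvPolynomial σ K) :
    IsIntegral (Algebra.adjoin K (Set.range P)) f := by
  classical
  set S := Algebra.adjoin K (Set.range P)
  -- Nullstellensatz: the zero locus of the `P i` is contained in the origin.
  have hrad : ∀ i, ∃ N, X i ^ N ∈ Ideal.span (Set.range P) := by
    intro i
    have : X i ∈ (Ideal.span (Set.range P)).radical := by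
      rw [← vanishingIdeal_zeroLocus_eq_radical (K := K), mem_vanishingIdeal_iff, zeroLocus_span]
      intro v hv
      have : v = 0 := h0 v fun j => by simpa using hv (P j) ⟨j, rfl⟩
      simp [this]
    exact this
  choose N hN using hrad
  have hg : ∀ i, ∃ g : σ → MvPolynomial σ K,
      (∀ j, g j = 0 ∨ (g j).totalDegree + e j ≤ N i) ∧ ∑ j, g j * P j = X i ^ N i := by
    intro i
    obtain ⟨g, hg⟩ := (Submodule.mem_span_range_iff_exists_fun _).1 (hN i)
    -- Keeping only the component of the right degree makes the coefficients of strictly smaller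
    -- degree than `X i ^ N i`, which drives the induction below.
    refine ⟨fun j => if e j ≤ N i then homogeneousComponent (N i - e j) (g j) else 0, ?_, ?_⟩
    · intro j
      dsimp only
      split_ifs with h
      · have := (homogeneousComponent_isHomogeneous (N i - e j) (g j)).totalDegree_le
        right; omega
      · exact Or.inl rfl
    · have h := congrArg (homogeneousComponent (N i)) hg
      rw [homogeneousComponent_eq_self (isHomogeneous_X_pow i (N i)), map_sum] at h
      rw [← h]
      refine Finset.sum_congr rfl fun j _ => ?_
      rw [smul_eq_mul, homogeneousComponent_mul_of_isHomogeneous (hP j)]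
      dsimp only
      split_ifs <;> simp only [zero_mul]
  choose g hg1 hg2 using hg
  let T : Set (σ →₀ ℕ) := {u | ∀ i, u i ≤ N i}
  have hTfin : T.Finite := by
    have : T ⊆ Set.Iic (Finsupp.equivFunOnFinite.symm N) := fun u hu i => hu i
    exact (Set.finite_Iic _).subset this
  let W : Submodule S (MvPolynomial σ K) :=
    Submodule.span S ((fun u => monomial u (1 : K)) '' T)
  have hsmul : ∀ (a : K) (w), w ∈ W → C a * w ∈ W := by
    intro a w hw
    exact W.smul_mem (algebraMap K S a) hw
  have hPmul : ∀ j w, w ∈ W → w * P j ∈ W := by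
    intro j w hw
    have : P j ∈ S := Algebra.subset_adjoin ⟨j, rfl⟩
    have h := W.smul_mem ⟨P j, this⟩ hw
    rwa [Subalgebra.smul_def, smul_eq_mul, mul_comm] at h
  -- The finitely many monomials in the box `T` generate the ring as an `S`-module: a monomial
  -- outside the box is divisible by some `X i ^ N i`, which is rewritten as a combination of the `P
  -- j`.
  have hall : ∀ n, ∀ f : MvPolynomial σ K, f.totalDegree < n → f ∈ W := by
    intro n
    induction n with
    | zero => intro f hf; omega
    | succ n ih =>
      intro f hf
      rw [f.as_sum]
      refine W.sum_mem fun u hu => ?_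
      rw [show monomial u (coeff u f) = C (coeff u f) * monomial u 1 by rw [C_mul_monomial, mul_one]]
      refine hsmul _ _ ?_
      by_cases hT : u ∈ T
      · exact Submodule.subset_span ⟨u, hT, rfl⟩
      · simp only [T, Set.mem_ofPred_eq, not_forall, not_le] at hT
        obtain ⟨i, hi⟩ := hT
        have hle : Finsupp.single i (N i) ≤ u := by
          rw [Finsupp.single_le_iff]; exact hi.le
        have hm : monomial u (1 : K) = monomial (u - Finsupp.single i (N i)) 1 * X i ^ N i := by
          rw [X_pow_eq_monomial, monomial_mul, mul_one, tsub_add_cancel_of_le hle]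
        rw [hm, ← hg2 i, Finset.mul_sum]
        refine W.sum_mem fun j _ => ?_
        rw [← mul_assoc]
        refine hPmul _ _ ?_
        rcases hg1 i j with h | h
        · rw [h, mul_zero]; exact W.zero_mem
        · apply ih
          have h1 := totalDegree_mul (monomial (u - Finsupp.single i (N i)) (1 : K)) (g i j)
          have h2 : (monomial (u - Finsupp.single i (N i)) (1 : K)).totalDegree + N i = u.degree := by
            rw [totalDegree_monomial _ one_ne_zero]
            conv_rhs => rw [← tsub_add_cancel_of_le hle, map_add, Finsupp.degree_single]
            rfl
          have h3 : u.degree ≤ f.totalDegree := by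
            exact le_totalDegree hu
          have := he j
          omega
  have hfg : W = ⊤ := top_le_iff.1 fun f _ => hall _ f (Nat.lt_succ_self _)
  have : Module.Finite S (MvPolynomial σ K) :=
    ⟨hfg ▸ Submodule.fg_span (hTfin.image _)⟩
  exact IsIntegral.of_finite S f

/-- A polynomial map with homogeneous components and no common zero is generically étale. -/
theorem det_jacobian_ne_zero [DecidableEq σ] [IsAlgClosed K] [CharZero K]
    {P : σ → MvPolynomial σ K} {e : σ → ℕ}
    (he : ∀ i, 0 < e i) (hP : ∀ i, (P i).IsHomogeneous (e i))
    (h0 : ∀ v : σ → K, (∀ i, eval v (P i) = 0) → v = 0) : (jacobian P).det ≠ 0 := by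
  intro hdet
  obtain ⟨v, hv, hJ⟩ := Matrix.exists_mulVec_eq_zero_iff.2 hdet
  -- A kernel vector of the Jacobian matrix is a derivation killing every `P i`, hence everything
  -- integral over them, hence each coordinate.
  let D : Derivation K (MvPolynomial σ K) (MvPolynomial σ K) := ∑ j, v j • pderiv j
  have hDapp : ∀ f, D f = ∑ j, v j * pderiv j f := by
    intro f
    have h := congrFun (map_sum (Derivation.coeFnAddMonoidHom (R := K) (A := MvPolynomial σ K)
      (M := MvPolynomial σ K)) (fun j => v j • pderiv j) Finset.univ) f
    rw [Finset.sum_apply] at h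
    exact h
  have hDP : ∀ i, D (P i) = 0 := by
    intro i
    rw [hDapp]
    have := congrFun hJ i
    simpa [Matrix.mulVec, dotProduct, jacobian, mul_comm] using this
  have hDS : ∀ s ∈ Algebra.adjoin K (Set.range P), D s = 0 := by
    intro s hs
    induction hs using Algebra.adjoin_induction with
    | mem x hx => obtain ⟨i, rfl⟩ := hx; exact hDP i
    | algebraMap r => exact D.map_algebraMap r
    | add x y _ _ hx hy => rw [map_add, hx, hy, add_zero]
    | mul x y _ _ hx hy => rw [D.leibniz, hx, hy]; simp
  apply hv
  funext i
  have h := derivation_eq_zero_of_isIntegral _ D hDS (isIntegral_of_no_common_zero he hP h0 (X i))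
  rw [hDapp] at h
  simpa [pderiv_X, Pi.single_apply] using h

end Jacobian

/-! ### Lifts of holomorphic self-maps of the plane -/

/-- The components of the polynomial map `P` have no common zero except the origin. -/
def NoCommonZero (P : Fin 3 → Poly) : Prop := ∀ v, evalMap P v = 0 → v = 0

theorem IsGivenBy.noCommonZero {φ : P2 → P2} {P : Fin 3 → Poly} (h : IsGivenBy φ P) :
    NoCommonZero P := by
  intro v hv
  by_contra hne
  exact (h v hne).1 hv

theorem eval_smul_of_isHomogeneous {f : Poly} {n : ℕ} (hf : f.IsHomogeneous n) (c : ℂ)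
    (v : Fin 3 → ℂ) : eval (c • v) f = c ^ n * eval v f := by
  rw [eval_eq, eval_eq, Finset.mul_sum]
  refine Finset.sum_congr rfl fun u hu => ?_
  have hu' : u.degree = n := by
    by_contra h
    exact (mem_support_iff.1 hu) (hf.coeff_eq_zero h)
  rw [← hu', Finsupp.degree_eq_sum]
  simp only [Pi.smul_apply, smul_eq_mul, mul_pow, Finset.prod_mul_distrib,
    Finset.prod_pow_eq_pow_sum]
  rw [Finset.sum_subset (Finset.subset_univ u.support)
    (fun i _ hi => Finsupp.notMem_support_iff.1 hi)]
  ring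

theorem eval_bind₁ (P : Fin 3 → Poly) (f : Poly) (v : Fin 3 → ℂ) :
    eval v (bind₁ P f) = eval (evalMap P v) f := by
  induction f using MvPolynomial.induction_on with
  | C a => simp
  | add p q hp hq => simp [hp, hq]
  | mul_X p i hp => simp [hp, evalMap]

/-- Otherwise the triple `f, g, g` has no common zero off the origin, yet its Jacobian matrix has
two equal rows. This replaces dimension theory for intersecting plane curves. -/
theorem exists_common_zero {f g : Poly} {d e : ℕ} (hd : 0 < d) (he : 0 < e)
    (hf : f.IsHomogeneous d) (hg : g.IsHomogeneous e) :
    ∃ v : Fin 3 → ℂ, v ≠ 0 ∧ eval v f = 0 ∧ eval v g = 0 := by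
  by_contra! H
  refine det_jacobian_ne_zero (P := ![f, g, g]) (e := ![d, e, e]) ?_ ?_ ?_ ?_
  · intro i; fin_cases i <;> assumption
  · intro i; fin_cases i <;> assumption
  · intro v hv
    by_contra hne
    exact H v hne (hv 0) (hv 1)
  · refine Matrix.det_zero_of_row_eq (i := 1) (j := 2) (by decide) ?_
    funext j
    simp [jacobian]

theorem isUnit_of_totalDegree_eq_zero {f : Poly} (hf : f ≠ 0) (h : f.totalDegree = 0) :
    IsUnit f := by
  rw [totalDegree_eq_zero_iff_eq_C] at h
  rw [h]
  refine IsUnit.map C (isUnit_iff_ne_zero.2 fun h0 => hf ?_)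
  rw [h, h0, C_0]

section Lift

variable {P : Fin 3 → Poly} {d : ℕ}

theorem component_ne_zero (hd : 0 < d) (hP : ∀ i, (P i).IsHomogeneous d) (h0 : NoCommonZero P)
    (i : Fin 3) : P i ≠ 0 := by
  intro hi
  obtain ⟨j, k, hjk⟩ : ∃ j k : Fin 3, ∀ m, m = i ∨ m = j ∨ m = k := by clear hi; revert i; decide
  obtain ⟨v, hv, hj, hk⟩ := exists_common_zero hd hd (hP j) (hP k)
  refine hv (h0 v ?_)
  funext m
  rcases hjk m with rfl | rfl | rfl <;> simp [evalMap, *]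

/-- A nonconstant common factor would meet the zero curve of the third component, giving a common
zero of all three. -/
theorem isRelPrime_component (hd : 0 < d) (hP : ∀ i, (P i).IsHomogeneous d) (h0 : NoCommonZero P)
    {i j : Fin 3} (hij : i ≠ j) : IsRelPrime (P i) (P j) := by
  intro c hci hcj
  have hi := component_ne_zero hd hP h0 i
  have hc0 : c ≠ 0 := ne_zero_of_dvd_ne_zero hi hci
  refine isUnit_of_totalDegree_eq_zero hc0 ?_
  by_contra hdeg
  obtain ⟨k, hk⟩ : ∃ k : Fin 3, ∀ m, m = i ∨ m = j ∨ m = k := by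
    clear hci hcj hi; revert i j; decide
  obtain ⟨v, hv, h1, h2⟩ := exists_common_zero (Nat.pos_of_ne_zero hdeg) hd
    (isHomogeneous_of_dvd (hP i) hi hci) (hP k)
  have hz : ∀ f, c ∣ f → eval v f = 0 := by
    rintro f ⟨g, rfl⟩
    rw [map_mul, h1, zero_mul]
  refine hv (h0 v ?_)
  funext m
  rcases hk m with rfl | rfl | rfl
  · exact hz _ hci
  · exact hz _ hcj
  · exact h2

theorem exists_eq_mul_of_parallel (hd : 0 < d) (hP : ∀ i, (P i).IsHomogeneous d)
    (h0 : NoCommonZero P) {W : Fin 3 → Poly} (hW : ∀ i j, P i * W j = P j * W i) :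
    ∃ g, ∀ i, W i = g * P i := by
  have h1 : P 0 ∣ P 1 * W 0 := ⟨W 1, (hW 0 1).symm⟩
  obtain ⟨g, hg⟩ := (isRelPrime_component hd hP h0 (by decide)).dvd_of_dvd_mul_left h1
  refine ⟨g, fun i => ?_⟩
  apply mul_left_cancel₀ (component_ne_zero hd hP h0 0)
  rw [hW 0 i, hg]
  ring

end Lift

/-- Two lifts are pointwise proportional, so by coprimality `Q = g P`; here `g` is homogeneous
without zeros off the origin, hence constant. This reconciles the lift in `IsHolomorphicOfDegree`
with the one in `IsPullback`. -/
theorem degree_eq_of_isGivenBy {φ : P2 → P2} {P Q : Fin 3 → Poly} {d e : ℕ} (hd : 0 < d)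
    (hP : ∀ i, (P i).IsHomogeneous d) (hQ : ∀ i, (Q i).IsHomogeneous e)
    (hφP : IsGivenBy φ P) (hφQ : IsGivenBy φ Q) : d = e := by
  have hpar : ∀ i j, P i * Q j = P j * Q i := by
    intro i j
    refine MvPolynomial.funext fun v => ?_
    by_cases hv : v = 0
    · subst hv
      have : ∀ i, eval 0 (P i) = 0 := by
        intro i
        have := eval_smul_of_isHomogeneous (hP i) 0 0
        rwa [zero_smul, zero_pow hd.ne', zero_mul] at this
      simp only [map_mul, this, zero_mul]
    · obtain ⟨h1, h2⟩ := hφP v hv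
      obtain ⟨h3, h4⟩ := hφQ v hv
      rw [h2, Projectivization.mk_eq_mk_iff'] at h4
      obtain ⟨a, ha⟩ := h4
      have ha' : ∀ i, eval v (P i) = a * eval v (Q i) := fun i => (congrFun ha i).symm
      simp only [map_mul, ha']
      ring
  obtain ⟨g, hg⟩ := exists_eq_mul_of_parallel hd hP hφP.noCommonZero hpar
  have hg0 : ∀ v, v ≠ 0 → eval v g ≠ 0 := by
    intro v hv h
    refine hv (hφQ.noCommonZero v (funext fun i => ?_))
    simp [evalMap, hg, h]
  obtain ⟨v, hv, -⟩ := exists_common_zero hd hd (hP 0) (hP 0)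
  have hgne : g ≠ 0 := fun h => hg0 v hv (by simp [h])
  have hP0 := component_ne_zero hd hP hφP.noCommonZero 0
  have hQ0 : Q 0 ≠ 0 := by rw [hg]; exact mul_ne_zero hgne hP0
  have hdeg : g.totalDegree + d = e := by
    rw [← (hQ 0).totalDegree hQ0, hg, totalDegree_mul_of_isDomain hgne hP0, (hP 0).totalDegree hP0]
  by_contra hne
  have hgh := isHomogeneous_of_dvd (hQ 0) hQ0 ⟨P 0, hg 0⟩
  obtain ⟨w, hw, hw', -⟩ := exists_common_zero (by omega) (by omega) hgh hgh
  exact hg0 w hw hw'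

/-! ### Isolated singularities and divisibility -/

/-- There is a line avoiding the singularities of a foliation. -/
theorem exists_line_avoiding_singularities (F : Foliation) :
    ∃ m : Fin 3 → ℂ, ∀ v, v ≠ 0 → evalMap F.form v = 0 → m ⬝ᵥ v ≠ 0 := by
  classical
  let S := F.isolated.toFinset
  let G : Poly := ∏ p ∈ S, ∑ i, C (p.rep i) * X i
  have hG : G ≠ 0 := by
    refine Finset.prod_ne_zero_iff.2 fun p _ h => p.rep_nonzero ?_
    funext j
    have := congrArg (eval (Pi.single j 1)) h
    simpa [Pi.single_apply] using this
  obtain ⟨m, hm⟩ : ∃ m, eval m G ≠ 0 := by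
    by_contra! H
    exact hG (MvPolynomial.funext fun v => by rw [H v, map_zero])
  refine ⟨m, fun v hv h => ?_⟩
  obtain ⟨a, ha⟩ := Projectivization.exists_smul_eq_mk_rep ℂ v hv
  have hS : Projectivization.mk ℂ v hv ∈ S := by
    rw [Set.Finite.mem_toFinset, Set.mem_ofPred_eq, ← ha]
    funext i
    have := eval_smul_of_isHomogeneous (F.homogeneous i) a v
    rw [show eval v (F.form i) = 0 from congrFun h i, mul_zero] at this
    exact this
  rw [eval_prod, Finset.prod_ne_zero_iff] at hm
  have h1 := hm _ hS
  intro h2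
  apply h1
  rw [← ha, map_sum]
  calc ∑ i, eval m (C ((a • v) i) * X i) = a * (m ⬝ᵥ v) := by
        simp [dotProduct, Finset.mul_sum, Units.smul_def]
        exact Finset.sum_congr rfl fun i _ => by ring
    _ = 0 := by rw [h2, mul_zero]

theorem exists_ne_zero_dotProduct_eq_zero (m : Fin 3 → ℂ) : ∃ v, v ≠ 0 ∧ m ⬝ᵥ v = 0 := by
  by_cases h : m 0 = 0
  · refine ⟨![1, 0, 0], fun h' => by simpa using congrFun h' 0, ?_⟩
    simp [dotProduct, Fin.sum_univ_three, h]
  · refine ⟨![m 1, - m 0, 0], fun h' => h (by simpa using congrFun h' 1), ?_⟩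
    simp [dotProduct, Fin.sum_univ_three]
    ring

theorem form_ne_zero (F : Foliation) : F.form ≠ 0 := by
  intro h
  obtain ⟨m, hm⟩ := exists_line_avoiding_singularities F
  obtain ⟨v, hv, hmv⟩ := exists_ne_zero_dotProduct_eq_zero m
  exact hm v hv (by rw [h]; funext i; simp [evalMap]) hmv

/-- The pull-back of the coefficients of a foliation by a finite map has no common factor. -/
theorem isUnit_of_dvd_bind₁_form (F : Foliation) {P : Fin 3 → Poly} {d : ℕ} (hd : 0 < d)
    (hP : ∀ i, (P i).IsHomogeneous d) (h0 : NoCommonZero P) {c : Poly} (hc0 : c ≠ 0)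
    (hc : ∀ i, c ∣ bind₁ P (F.form i)) : IsUnit c := by
  obtain ⟨m, hm⟩ := exists_line_avoiding_singularities F
  have hℓ : (∑ i, C (m i) * P i).IsHomogeneous d :=
    IsHomogeneous.sum _ _ _ fun i _ => (hP i).C_mul _
  -- Such a `v` would be mapped to a singularity on the line `m`. A nonconstant common factor `c`
  -- yields one: a common zero of `c` and the pulled-back equation of that line.
  have contra : ∀ v : Fin 3 → ℂ, v ≠ 0 → (∀ i, eval v (bind₁ P (F.form i)) = 0) →
      eval v (∑ i, C (m i) * P i) = 0 → False := by
    intro v hv h1 h2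
    refine hm (evalMap P v) (fun h => hv (h0 v h)) (funext fun i => ?_) ?_
    · rw [evalMap, ← eval_bind₁]; exact h1 i
    · simpa [dotProduct, evalMap] using h2
  obtain ⟨i, hi⟩ : ∃ i, bind₁ P (F.form i) ≠ 0 := by
    by_contra! H
    obtain ⟨v, hv, h1, -⟩ := exists_common_zero hd hd hℓ hℓ
    exact contra v hv (fun i => by rw [H i, map_zero]) h1
  have hhom : (bind₁ P (F.form i)).IsHomogeneous (d * F.n) :=
    (F.homogeneous i).aeval P hP
  refine isUnit_of_totalDegree_eq_zero hc0 ?_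
  by_contra hdeg
  obtain ⟨v, hv, h1, h2⟩ := exists_common_zero (Nat.pos_of_ne_zero hdeg) hd
    (isHomogeneous_of_dvd hhom hi (hc i)) hℓ
  refine contra v hv (fun j => ?_) h2
  obtain ⟨g, hg⟩ := hc j
  rw [hg, map_mul, h1, zero_mul]

/-- Each prime factor `p` of `h` fails to divide some `B i`, so it divides `D`; it is then cancelled
from `h` and `D`. -/
theorem dvd_of_forall_dvd_mul {R ι : Type*} [CommRing R] [IsDomain R]
    [UniqueFactorizationMonoid R] {B : ι → R} (hB : ∀ c, c ≠ 0 → (∀ i, c ∣ B i) → IsUnit c)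
    {h : R} (hh : h ≠ 0) : ∀ D : R, (∀ i, h ∣ D * B i) → h ∣ D := by
  induction h using UniqueFactorizationMonoid.induction_on_prime with
  | h₁ => exact absurd rfl hh
  | h₂ x hx => exact fun D _ => hx.dvd
  | h₃ a p ha hp ih =>
    intro D hD
    have hex : ∃ i, ¬ p ∣ B i := by
      by_contra! H
      exact hp.not_isUnit (hB p hp.ne_zero H)
    obtain ⟨i, hi⟩ := hex
    obtain ⟨D, rfl⟩ := (hp.dvd_or_dvd (dvd_of_mul_right_dvd (hD i))).resolve_right hi
    refine mul_dvd_mul_left p (ih ha D fun j => ?_)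
    have := hD j
    rw [mul_assoc] at this
    exact (mul_dvd_mul_iff_left hp.ne_zero).1 this

/-! ### The ramification divisor bounds the degree -/

theorem pullback_eq_vecMul (P : Fin 3 → Poly) (A : OneForm) :
    pullback P A = (fun i => bind₁ P (A i)) ᵥ* jacobian P := rfl

theorem det_jacobian_smul {P : Fin 3 → Poly} {A : OneForm} {h : Poly}
    (hA : ∀ i, pullback P A i = h * A i) :
    (jacobian P).det • (fun i => bind₁ P (A i)) = h • (A ᵥ* (jacobian P).adjugate) := by
  have h1 : pullback P A = h • A := funext hA
  rw [← Matrix.smul_vecMul, ← h1, pullback_eq_vecMul, Matrix.vecMul_vecMul, Matrix.mul_adjugate,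
    Matrix.vecMul_smul, Matrix.vecMul_one]

theorem dvd_det_jacobian (F : Foliation) {P : Fin 3 → Poly} {d : ℕ} (hd : 0 < d)
    (hP : ∀ i, (P i).IsHomogeneous d) (h0 : NoCommonZero P) {h : Poly} (hh : h ≠ 0)
    (hA : ∀ i, pullback P F.form i = h * F.form i) : h ∣ (jacobian P).det := by
  refine dvd_of_forall_dvd_mul (B := fun i => bind₁ P (F.form i))
    (fun c hc0 hc => isUnit_of_dvd_bind₁_form F hd hP h0 hc0 hc) hh _ fun i => ?_
  exact ⟨_, congrFun (det_jacobian_smul hA) i⟩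

theorem isHomogeneous_det_jacobian {P : Fin 3 → Poly} {d : ℕ} (hP : ∀ i, (P i).IsHomogeneous d) :
    (jacobian P).det.IsHomogeneous (3 * (d - 1)) := by
  rw [Matrix.det_apply]
  refine IsHomogeneous.sum _ _ _ fun s _ => ?_
  have : (∏ i, jacobian P (s i) i).IsHomogeneous (∑ _i : Fin 3, (d - 1)) :=
    IsHomogeneous.prod _ _ _ fun i _ => (hP _).pderiv
  rw [Finset.sum_const, Finset.card_univ, Fintype.card_fin, smul_eq_mul] at this
  rcases Int.units_eq_one_or (Equiv.Perm.sign s) with h | h <;> rw [h]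
  · simpa using this
  · simpa using this.neg

/-- An invariant foliation has degree at most one; in degree one the ramification divisor is
the zero divisor of the factor `h`. -/
theorem invariant_form_degree (F : Foliation) {P : Fin 3 → Poly} {d : ℕ} (hd : 2 ≤ d)
    (hP : ∀ i, (P i).IsHomogeneous d) (h0 : NoCommonZero P) {h : Poly} (hh : h ≠ 0)
    (hA : ∀ i, pullback P F.form i = h * F.form i) :
    F.n ≤ 2 ∧ (F.n = 2 → ∃ k : ℂ, k ≠ 0 ∧ (jacobian P).det = C k * h) := by
  have hd0 : 0 < d := by omega
  have hJ : (jacobian P).det ≠ 0 := det_jacobian_ne_zero (fun _ => hd0) hP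
    fun v hv => h0 v (funext hv)
  obtain ⟨k, hk⟩ := dvd_det_jacobian F hd0 hP h0 hh hA
  have hk0 : k ≠ 0 := right_ne_zero_of_mul (hk ▸ hJ)
  obtain ⟨i, hi⟩ := Function.ne_iff.1 (form_ne_zero F)
  have h1 : (pullback P F.form i).IsHomogeneous (d * F.n + (d - 1)) :=
    IsHomogeneous.sum _ _ _ fun j _ => ((F.homogeneous j).aeval P hP).mul (hP j).pderiv
  have h2 : h.totalDegree + F.n = d * F.n + (d - 1) := by
    -- Degrees in `P^* ω = h ω`: the pull-back contributes `d * n` from the coefficients and `d - 1`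
    -- from the differentials.
    rw [← (F.homogeneous i).totalDegree hi, ← totalDegree_mul_of_isDomain hh hi, ← hA i,
      h1.totalDegree (by rw [hA i]; exact mul_ne_zero hh hi), (F.homogeneous i).totalDegree hi]
  have h3 : h.totalDegree + k.totalDegree = 3 * (d - 1) := by
    rw [← totalDegree_mul_of_isDomain hh hk0, ← hk, (isHomogeneous_det_jacobian hP).totalDegree hJ]
  obtain ⟨e, rfl⟩ : ∃ e, d = e + 2 := ⟨d - 2, by omega⟩
  have h4 : (e + 1) * F.n + (e + 1) = h.totalDegree := by
    have : e + 2 - 1 = e + 1 := rfl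
    rw [this] at h2
    linarith
  have h5 : (e + 1) * F.n ≤ (e + 1) * 2 := by
    have : e + 2 - 1 = e + 1 := rfl
    rw [this] at h3
    linarith
  refine ⟨Nat.le_of_mul_le_mul_left h5 (Nat.succ_pos e), fun hn => ?_⟩
  have h6 : k.totalDegree = 0 := by
    have : e + 2 - 1 = e + 1 := rfl
    rw [this] at h3
    rw [hn] at h4
    linarith
  rw [totalDegree_eq_zero_iff_eq_C] at h6
  refine ⟨coeff 0 k, fun h => hk0 (by rw [h6, h, C_0]), ?_⟩
  rw [← h6, hk, mul_comm]

/-! ### The vector field tangent to a foliation -/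

theorem mulVec_cross_mulVec {R : Type*} [CommRing R] (M : Matrix (Fin 3) (Fin 3) R)
    (a b : Fin 3 → R) : (M *ᵥ a) ⨯₃ (M *ᵥ b) = (a ⨯₃ b) ᵥ* M.adjugate := by
  rw [Matrix.adjugate_fin_three]
  funext i
  fin_cases i <;>
  · simp [cross_apply, Matrix.mulVec, Matrix.vecMul, dotProduct, Fin.sum_univ_three]
    ring

theorem mul_eq_mul_of_cross_eq_zero {R : Type*} [CommRing R] {v w : Fin 3 → R}
    (h : v ⨯₃ w = 0) (i j : Fin 3) : v i * w j = v j * w i := by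
  have e0 := congrFun h 0
  have e1 := congrFun h 1
  have e2 := congrFun h 2
  simp [cross_apply] at e0 e1 e2
  fin_cases i <;> fin_cases j <;> simp <;> grind

/-- The curl of a one-form. -/
def curl (A : OneForm) : Fin 3 → Poly :=
  ![pderiv 1 (A 2) - pderiv 2 (A 1), pderiv 2 (A 0) - pderiv 0 (A 2),
    pderiv 0 (A 1) - pderiv 1 (A 0)]

/-- Cartan's formula for the radial field `R`: as `ι_R ω = 0`, `ι_R dω` is the Lie derivative of `ω`
along `R`, which multiplies `ω` by `n + 1`. In coordinates: Euler's identity minus the derivatives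
of the radial relation. -/
theorem cross_curl {A : OneForm} {n : ℕ} (hA : ∀ i, (A i).IsHomogeneous n)
    (hr : ∑ i, X i * A i = 0) : curl A ⨯₃ X = ((n + 1 : ℕ) : Poly) • A := by
  have hE : ∀ i, X 0 * pderiv 0 (A i) + X 1 * pderiv 1 (A i) + X 2 * pderiv 2 (A i)
      = (n : Poly) * A i := by
    intro i
    have := (hA i).sum_X_mul_pderiv
    rwa [Fin.sum_univ_three, nsmul_eq_mul] at this
  rw [Fin.sum_univ_three] at hr
  have hD : ∀ j, pderiv j (X 0 * A 0 + X 1 * A 1 + X 2 * A 2) = 0 := fun j => by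
    rw [hr, map_zero]
  have h0 := hD 0
  have h1 := hD 1
  have h2 := hD 2
  simp only [map_add, pderiv_mul, pderiv_X_self, pderiv_X_of_ne, ne_eq, Fin.reduceEq,
    not_false_eq_true, zero_mul, one_mul, zero_add] at h0 h1 h2
  have e0 := hE 0
  have e1 := hE 1
  have e2 := hE 2
  funext i
  fin_cases i
  · simp [cross_apply, curl]
    linear_combination e0 - h0
  · simp [cross_apply, curl]
    linear_combination e1 - h1
  · simp [cross_apply, curl]
    linear_combination e2 - h2

/-- A foliation is tangent to a homogeneous vector field. -/
theorem exists_vectorField (F : Foliation) : ∃ V : Fin 3 → Poly,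
    (∀ i, (V i).IsHomogeneous (F.n - 1)) ∧ F.form = X ⨯₃ V ∧ F.n ≠ 0 := by
  have hc : ((F.n + 1 : ℕ) : ℂ) ≠ 0 := Nat.cast_ne_zero.2 (Nat.succ_ne_zero _)
  have h := cross_curl F.homogeneous F.radial
  have hcurl : ∀ i, (curl F.form i).IsHomogeneous (F.n - 1) := by
    have hp : ∀ i j, (pderiv i (F.form j)).IsHomogeneous (F.n - 1) :=
      fun i j => (F.homogeneous j).pderiv
    intro i
    fin_cases i <;> exact (hp _ _).sub (hp _ _)
  have hform : F.form = X ⨯₃ (fun i => C (-((F.n + 1 : ℕ) : ℂ)⁻¹) * curl F.form i) := by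
    have h1 : (fun i => C (-((F.n + 1 : ℕ) : ℂ)⁻¹) * curl F.form i) =
        (C (-((F.n + 1 : ℕ) : ℂ)⁻¹) : Poly) • curl F.form := rfl
    rw [h1, map_smul, ← cross_anticomm, h, smul_neg, ← neg_smul, smul_smul]
    rw [show ((F.n + 1 : ℕ) : Poly) = C ((F.n + 1 : ℕ) : ℂ) by rw [map_natCast], ← C_neg, ← C_mul,
      neg_neg, inv_mul_cancel₀ hc, C_1, one_smul]
  -- For `n = 0` the coefficients are constant, so the curl and with it the form would vanish.
  refine ⟨_, fun i => (hcurl i).C_mul _, hform, fun hn => form_ne_zero F ?_⟩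
  have hz : ∀ i j, pderiv i (F.form j) = 0 := by
    intro i j
    have := F.homogeneous j
    rw [hn, ← totalDegree_zero_iff_isHomogeneous, totalDegree_eq_zero_iff_eq_C] at this
    rw [this, pderiv_C]
  rw [hform]
  funext i
  fin_cases i <;> simp [cross_apply, curl, hz]

theorem exists_eq_linearForms {V : Fin 3 → Poly} (hV : ∀ i, (V i).IsHomogeneous 1) :
    ∃ L : Matrix (Fin 3) (Fin 3) ℂ, V = L.map C *ᵥ X := by
  refine ⟨Matrix.of fun i j => coeff 0 (pderiv j (V i)), funext fun i => ?_⟩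
  have h1 := (hV i).sum_X_mul_pderiv
  rw [one_smul] at h1
  have h2 : ∀ j, pderiv j (V i) = C (coeff 0 (pderiv j (V i))) := by
    intro j
    have := (hV i).pderiv (i := j)
    rw [← totalDegree_zero_iff_isHomogeneous, totalDegree_eq_zero_iff_eq_C] at this
    exact this
  conv_lhs => rw [← h1]
  simp only [Matrix.mulVec, dotProduct, Matrix.map_apply, Matrix.of_apply]
  exact Finset.sum_congr rfl fun j _ => by rw [← h2 j, mul_comm]

theorem evalMap_cross (U V : Fin 3 → Poly) (v : Fin 3 → ℂ) :
    evalMap (U ⨯₃ V) v = evalMap U v ⨯₃ evalMap V v := by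
  funext i
  fin_cases i <;> simp [cross_apply, evalMap]

theorem evalMap_X (v : Fin 3 → ℂ) : evalMap X v = v := by
  funext i; simp [evalMap]

theorem evalMap_map_C_mulVec (L : Matrix (Fin 3) (Fin 3) ℂ) (V : Fin 3 → Poly) (v : Fin 3 → ℂ) :
    evalMap (L.map C *ᵥ V) v = L *ᵥ evalMap V v := by
  funext i
  simp [evalMap, Matrix.mulVec, dotProduct]

theorem evalMap_C (u : Fin 3 → ℂ) (v : Fin 3 → ℂ) : evalMap (fun i => C (u i)) v = u := by
  funext i; simp [evalMap]

theorem bind₁_cross (P U V : Fin 3 → Poly) :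
    (fun i => bind₁ P ((U ⨯₃ V) i)) = (fun i => bind₁ P (U i)) ⨯₃ (fun i => bind₁ P (V i)) := by
  funext i
  fin_cases i <;> simp [cross_apply]

theorem bind₁_map_C_mulVec (P V : Fin 3 → Poly) (L : Matrix (Fin 3) (Fin 3) ℂ) :
    (fun i => bind₁ P ((L.map C *ᵥ V) i)) = L.map C *ᵥ (fun i => bind₁ P (V i)) := by
  funext i
  simp [Matrix.mulVec, dotProduct]

theorem jacobian_mulVec_X {P : Fin 3 → Poly} {d : ℕ} (hP : ∀ i, (P i).IsHomogeneous d) :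
    jacobian P *ᵥ X = (C (d : ℂ) : Poly) • P := by
  funext i
  have := (hP i).sum_X_mul_pderiv
  simp only [nsmul_eq_mul] at this
  simp only [Matrix.mulVec, dotProduct, jacobian, Matrix.of_apply, Pi.smul_apply, smul_eq_mul,
    map_natCast]
  rw [← this]
  exact Finset.sum_congr rfl fun j _ => mul_comm _ _

/-- A map preserving the foliation tangent to the linear vector field `L` sends this vector field
to a multiple of itself, up to the radial vector field. -/
theorem exists_equivariance (F : Foliation) {L : Matrix (Fin 3) (Fin 3) ℂ}
    (hL : F.form = X ⨯₃ (L.map C *ᵥ X)) {P : Fin 3 → Poly} {d : ℕ} (hd : 0 < d)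
    (hP : ∀ i, (P i).IsHomogeneous d) (h0 : NoCommonZero P) {h : Poly} (hh : h ≠ 0)
    (hA : ∀ i, pullback P F.form i = h * F.form i) {k : ℂ} (hk : k ≠ 0)
    (hJ : (jacobian P).det = C k * h) :
    ∃ a b : ℂ, a ≠ 0 ∧ jacobian P *ᵥ (L.map C *ᵥ X) =
      (C a : Poly) • (L.map C *ᵥ P) + (C b : Poly) • P := by
  have hd' : (d : ℂ) ≠ 0 := by exact_mod_cast hd.ne'
  have h1 := det_jacobian_smul hA
  have h2 : (fun i => bind₁ P (F.form i)) = P ⨯₃ (L.map C *ᵥ P) := by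
    rw [hL, bind₁_cross, bind₁_map_C_mulVec]
    simp only [bind₁_X_right]
  rw [h2] at h1
  rw [hL, ← mulVec_cross_mulVec, jacobian_mulVec_X hP, hJ] at h1
  set V := jacobian P *ᵥ (L.map C *ᵥ X) with hV
  -- With `det J = k h` and `J X = d P`, the adjugate relation reads `k h (P ⨯₃ L P) = h (d P ⨯₃
  -- V)`, and `h` cancels.
  have h3 : P ⨯₃ ((C k : Poly) • (L.map C *ᵥ P) - (C (d : ℂ) : Poly) • V) = 0 := by
    have h4 : h • (P ⨯₃ ((C k : Poly) • (L.map C *ᵥ P) - (C (d : ℂ) : Poly) • V)) = 0 := by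
      rw [map_sub, map_smul, map_smul, smul_sub, smul_smul, mul_comm h, h1, map_smul,
        LinearMap.smul_apply, sub_self]
    exact (smul_eq_zero.1 h4).resolve_left hh
  set W := (C k : Poly) • (L.map C *ᵥ P) - (C (d : ℂ) : Poly) • V with hW
  obtain ⟨g, hg⟩ := exists_eq_mul_of_parallel hd hP h0 (mul_eq_mul_of_cross_eq_zero h3)
  have hVhom : ∀ i, (V i).IsHomogeneous d := by
    intro i
    refine IsHomogeneous.sum _ _ _ fun j _ => ?_
    have : ((L.map C *ᵥ X) j : Poly).IsHomogeneous 1 :=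
      IsHomogeneous.sum _ _ _ fun l _ => (isHomogeneous_X ℂ l).C_mul _
    have h5 := ((hP i).pderiv (i := j)).mul this
    rwa [Nat.sub_add_cancel hd] at h5
  have hLhom : ∀ i, ((L.map C *ᵥ P) i : Poly).IsHomogeneous d := fun i =>
    IsHomogeneous.sum _ _ _ fun l _ => (hP l).C_mul _
  have hWhom : (W 0).IsHomogeneous d := ((hLhom 0).C_mul k).sub ((hVhom 0).C_mul d)
  have hP0 := component_ne_zero hd hP h0 0
  -- Both sides of `W = g P` have degree `d`, so the factor is constant.
  have hgC : g = C (coeff 0 g) := by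
    rw [← totalDegree_eq_zero_iff_eq_C]
    by_cases hg0 : g = 0
    · simp [hg0]
    · have h6 := totalDegree_mul_of_isDomain hg0 hP0
      rw [← hg 0, hWhom.totalDegree (by rw [hg]; exact mul_ne_zero hg0 hP0),
        (hP 0).totalDegree hP0] at h6
      omega
  refine ⟨k / d, -(coeff 0 g / d), div_ne_zero hk hd', funext fun i => ?_⟩
  have h7 := hg i
  rw [hgC, hW] at h7
  simp only [Pi.sub_apply, Pi.smul_apply, Pi.add_apply, smul_eq_mul] at h7 ⊢
  have hC : (C (d : ℂ) : Poly) ≠ 0 := by rwa [ne_eq, C_eq_zero]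
  apply mul_left_cancel₀ hC
  have e1 : (C (d : ℂ) : Poly) * C (k / d) = C k := by rw [← C_mul, mul_div_cancel₀ _ hd']
  have e2 : (C (d : ℂ) : Poly) * C (-(coeff 0 g / d)) = - C (coeff 0 g) := by
    rw [← C_mul, mul_neg, mul_div_cancel₀ _ hd', C_neg]
  linear_combination -h7 - e1 * (L.map C *ᵥ P) i - e2 * P i

/-- The eigenspaces of a linear vector field tangent to a foliation are lines. -/
theorem eigenvectors_proportional (F : Foliation) {L : Matrix (Fin 3) (Fin 3) ℂ}
    (hL : F.form = X ⨯₃ (L.map C *ᵥ X)) {c : ℂ} {v w : Fin 3 → ℂ} (hv0 : v ≠ 0)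
    (hv : L *ᵥ v = c • v) (hw : L *ᵥ w = c • w) : ∃ t : ℂ, w = t • v := by
  obtain ⟨m, hm⟩ := exists_line_avoiding_singularities F
  have hsing : ∀ u, L *ᵥ u = c • u → u ≠ 0 → m ⬝ᵥ u ≠ 0 := by
    intro u hu hu0
    refine hm u hu0 ?_
    rw [hL, evalMap_cross, evalMap_X, evalMap_map_C_mulVec, evalMap_X, hu, map_smul, cross_self,
      smul_zero]
  have hmv := hsing v hv hv0
  refine ⟨(m ⬝ᵥ w) / (m ⬝ᵥ v), ?_⟩
  by_contra hne
  -- Every eigenvector is a singular point; this combination is an eigenvector lying on the line `m`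
  -- that avoids the singularities.
  refine hsing (w - ((m ⬝ᵥ w) / (m ⬝ᵥ v)) • v) ?_ (sub_ne_zero.2 hne) ?_
  · rw [Matrix.mulVec_sub, Matrix.mulVec_smul, hv, hw, smul_sub, smul_comm]
  · rw [dotProduct_sub, dotProduct_smul, smul_eq_mul, div_mul_cancel₀ _ hmv, sub_self]

/-! ### Tangencies with a generic line -/

theorem exists_smul_of_cross_eq_zero {v w : Fin 3 → ℂ} (hv : v ≠ 0) (h : v ⨯₃ w = 0) :
    ∃ t : ℂ, w = t • v := by
  obtain ⟨i, hi⟩ := Function.ne_iff.1 hv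
  have hi' : v i ≠ 0 := hi
  refine ⟨w i / v i, funext fun j => ?_⟩
  rw [Pi.smul_apply, smul_eq_mul, div_mul_eq_mul_div, eq_div_iff hi']
  rw [mul_comm, mul_comm (w i)]
  exact mul_eq_mul_of_cross_eq_zero h i j

theorem cross_eq_zero_of_forall_dotProduct {a m : Fin 3 → ℂ}
    (h : ∀ w, m ⬝ᵥ w = 0 → a ⬝ᵥ w = 0) : a ⨯₃ m = 0 := by
  refine dotProduct_eq_zero_iff.1 fun x => ?_
  rw [dotProduct_comm, triple_product_permutation]
  exact h _ (dot_self_cross m x)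

/-- The leaves are the lines through `u`, so a line missing `u` is nowhere tangent. -/
theorem hasDegree_zero (F : Foliation) {u : Fin 3 → ℂ} (hu : u ≠ 0)
    (hF : F.form = X ⨯₃ (fun i => C (u i))) : HasDegree F 0 := by
  refine ⟨∑ i, C (u i) * X i, fun h => hu ?_, fun m hm hG => ?_⟩
  · funext j
    have := congrArg (eval (Pi.single j 1)) h
    simpa [Pi.single_apply] using this
  · have hum : u ⬝ᵥ m ≠ 0 := by simpa [dotProduct] using hG
    rw [Nat.cast_zero, Set.encard_eq_zero, Set.eq_empty_iff_forall_notMem]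
    rintro p ⟨hmp, hp⟩
    have h1 := cross_eq_zero_of_forall_dotProduct hp
    rw [hF, evalMap_cross, evalMap_X, evalMap_C] at h1
    rw [← cross_anticomm, neg_eq_zero] at h1
    obtain ⟨t, ht⟩ := exists_smul_of_cross_eq_zero hm h1
    have h2 := dot_cross_self p.rep u
    rw [ht, dotProduct_smul, smul_eq_mul, mul_eq_zero, or_iff_left hum] at h2
    rw [h2, zero_smul, ← cross_anticomm, neg_eq_zero] at ht
    obtain ⟨s, hs⟩ := exists_smul_of_cross_eq_zero hu ht
    rw [hs, dotProduct_smul, dotProduct_comm, smul_eq_mul, mul_eq_zero, or_iff_left hum] at hmp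
    exact p.rep_nonzero (by rw [hs, hmp, zero_smul])

/-- Were every covector an eigenvector of the transpose, `L` would be scalar and the form zero; five
test covectors suffice. -/
theorem exists_cross_transpose_ne_zero (F : Foliation) {L : Matrix (Fin 3) (Fin 3) ℂ}
    (hL : F.form = X ⨯₃ (L.map C *ᵥ X)) : ∃ m : Fin 3 → ℂ, m ⨯₃ (m ᵥ* L) ≠ 0 := by
  by_contra! H
  have h1 := H ![1, 0, 0]
  have h2 := H ![0, 1, 0]
  have h3 := H ![0, 0, 1]
  have h4 := H ![1, 1, 0]
  have h5 := H ![0, 1, 1]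
  simp [cross_apply, Matrix.vecMul, dotProduct, Fin.sum_univ_three] at h1 h2 h3 h4 h5
  refine form_ne_zero F ?_
  rw [hL]
  funext i
  fin_cases i <;>
  · simp [cross_apply, Matrix.mulVec, dotProduct, Fin.sum_univ_three, h1, h2, h3]
    grind

/-- Tangency to the line `m` at `p` means `m ⬝ᵥ p = 0` and `m ⬝ᵥ L p = 0`, so the only tangency is
`m ⨯₃ (m ᵥ* L)` when this is nonzero. -/
theorem hasDegree_one (F : Foliation) {L : Matrix (Fin 3) (Fin 3) ℂ}
    (hL : F.form = X ⨯₃ (L.map C *ᵥ X)) : HasDegree F 1 := by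
  obtain ⟨m₀, hm₀⟩ := exists_cross_transpose_ne_zero F hL
  obtain ⟨i, hi⟩ := Function.ne_iff.1 hm₀
  have hev : ∀ m : Fin 3 → ℂ, evalMap (X ⨯₃ (L.transpose.map C *ᵥ X)) m = m ⨯₃ (m ᵥ* L) := by
    intro m
    rw [evalMap_cross, evalMap_X, evalMap_map_C_mulVec, evalMap_X, Matrix.mulVec_transpose]
  refine ⟨(X ⨯₃ (L.transpose.map C *ᵥ X)) i, fun h => hi ?_, fun m hm hG => ?_⟩
  · rw [← hev, evalMap, h, map_zero]; rfl
  have hq : m ⨯₃ (m ᵥ* L) ≠ 0 := by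
    intro h
    apply hG
    have := congrFun (hev m) i
    rwa [h] at this
  have hform : ∀ v, evalMap F.form v = v ⨯₃ (L *ᵥ v) := by
    intro v
    rw [hL, evalMap_cross, evalMap_X, evalMap_map_C_mulVec, evalMap_X]
  rw [Nat.cast_one, Set.encard_eq_one]
  refine ⟨Projectivization.mk ℂ _ hq, Set.eq_singleton_iff_unique_mem.2 ⟨?_, ?_⟩⟩
  · obtain ⟨a, ha⟩ := Projectivization.exists_smul_eq_mk_rep ℂ _ hq
    refine ⟨?_, fun w hw => ?_⟩
    · rw [← ha, Units.smul_def, dotProduct_smul, dot_self_cross, smul_zero]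
    · rw [← ha, hform, Units.smul_def, Matrix.mulVec_smul, map_smul, map_smul,
        LinearMap.smul_apply, cross_cross_eq_smul_sub_smul, smul_dotProduct, smul_dotProduct,
        sub_dotProduct, smul_dotProduct, smul_dotProduct, hw]
      rw [Matrix.dotProduct_mulVec, dot_cross_self]
      simp
  · rintro p ⟨hmp, hp⟩
    have h1 := cross_eq_zero_of_forall_dotProduct hp
    rw [hform, cross_cross_eq_smul_sub_smul, dotProduct_comm p.rep m, hmp, zero_smul, zero_sub,
      neg_eq_zero, smul_eq_zero, or_iff_left p.rep_nonzero, dotProduct_comm,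
      Matrix.dotProduct_mulVec] at h1
    have h2 : (m ⨯₃ (m ᵥ* L)) ⨯₃ p.rep = 0 := by
      rw [cross_cross_eq_smul_sub_smul, hmp, h1, zero_smul, zero_smul, sub_zero]
    obtain ⟨t, ht⟩ := exists_smul_of_cross_eq_zero hq h2
    rw [← p.mk_rep, Projectivization.mk_eq_mk_iff']
    exact ⟨t, ht.symm⟩

/-! ### Polynomial integral curves and semisimplicity -/

theorem derivative_aeval (γ : Fin 3 → Polynomial ℂ) (f : Poly) :
    Polynomial.derivative (aeval γ f) =
      ∑ j, aeval γ (pderiv j f) * Polynomial.derivative (γ j) := by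
  induction f using MvPolynomial.induction_on with
  | C a => simp
  | add p q hp hq => simp [hp, hq, add_mul, Finset.sum_add_distrib]
  | mul_X p i hp =>
    rw [map_mul, Polynomial.derivative_mul, hp, aeval_X]
    simp only [pderiv_mul, map_add, map_mul, aeval_X, add_mul, Finset.sum_add_distrib]
    congr 1
    · rw [Finset.sum_mul]
      exact Finset.sum_congr rfl fun j _ => by ring
    · rw [Finset.sum_eq_single i]
      · simp
      · intro j _ hj
        rw [pderiv_X_of_ne hj.symm]
        simp
      · simp

theorem natDegree_aeval_le_and_coeff {γ : Fin 3 → Polynomial ℂ} {e : ℕ}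
    (hγ : ∀ j, (γ j).natDegree ≤ e) {f : Poly} {d : ℕ} (hf : f.IsHomogeneous d) :
    (aeval γ f).natDegree ≤ d * e ∧
      (aeval γ f).coeff (d * e) = eval (fun j => (γ j).coeff e) f := by
  have hpow : ∀ j k, ((γ j) ^ k).natDegree ≤ k * e ∧
      ((γ j) ^ k).coeff (k * e) = (γ j).coeff e ^ k := fun j k =>
    ⟨Polynomial.natDegree_pow_le_of_le k (hγ j), by
      exact Polynomial.coeff_pow_of_natDegree_le (hγ j)⟩
  have hmul : ∀ {p q : Polynomial ℂ} {k l : ℕ}, p.natDegree ≤ k * e → q.natDegree ≤ l * e →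
      (p * q).natDegree ≤ (k + l) * e ∧
        (p * q).coeff ((k + l) * e) = p.coeff (k * e) * q.coeff (l * e) := by
    intro p q k l hp hq
    rw [add_mul]
    exact ⟨Polynomial.natDegree_mul_le_of_le hp hq,
      Polynomial.coeff_mul_add_eq_of_natDegree_le hp hq⟩
  have hmon : ∀ u ∈ f.support,
      (Polynomial.C (coeff u f) * ∏ j, γ j ^ u j).natDegree ≤ d * e ∧
      (Polynomial.C (coeff u f) * ∏ j, γ j ^ u j).coeff (d * e) =
        coeff u f * ∏ j, (γ j).coeff e ^ u j := by
    intro u hu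
    have hu' : u 0 + u 1 + u 2 = d := by
      have h : u.degree = d := by
        by_contra h
        exact (mem_support_iff.1 hu) (hf.coeff_eq_zero h)
      rwa [Finsupp.degree_eq_sum, Fin.sum_univ_three] at h
    rw [Fin.prod_univ_three, Fin.prod_univ_three]
    have h1 := hmul (hpow 0 (u 0)).1 (hpow 1 (u 1)).1
    have h2 := hmul h1.1 (hpow 2 (u 2)).1
    rw [hu'] at h2
    refine ⟨(Polynomial.natDegree_C_mul_le _ _).trans h2.1, ?_⟩
    rw [Polynomial.coeff_C_mul, h2.2, h1.2, (hpow 0 _).2, (hpow 1 _).2, (hpow 2 _).2]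
  have hsum : aeval γ f = ∑ u ∈ f.support, Polynomial.C (coeff u f) * ∏ j, γ j ^ u j := by
    rw [aeval_def, eval₂_eq']
    rfl
  rw [hsum]
  refine ⟨Polynomial.natDegree_sum_le_of_forall_le _ _ fun u hu => (hmon u hu).1, ?_⟩
  rw [Polynomial.finsetSum_coeff, eval_eq']
  exact Finset.sum_congr rfl fun u hu => (hmon u hu).2

/-- A polynomial integral curve of a linear vector field is sent by an equivariant map to a
polynomial integral curve of another one. -/
theorem exists_nilpotent_vector {P : Fin 3 → Poly} {d : ℕ}
    (hP : ∀ i, (P i).IsHomogeneous d) (h0 : NoCommonZero P) {L : Matrix (Fin 3) (Fin 3) ℂ} {a b : ℂ}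
    (hE : jacobian P *ᵥ (L.map C *ᵥ X) = (C a : Poly) • (L.map C *ᵥ P) + (C b : Poly) • P)
    {c : ℂ} {γ : Fin 3 → Polynomial ℂ} {e : ℕ} (hγ : ∀ j, (γ j).natDegree ≤ e)
    (hγ0 : (fun j => (γ j).coeff e) ≠ 0)
    (hγ' : ∀ j, Polynomial.derivative (γ j) =
      (∑ l, Polynomial.C (L j l) * γ l) - Polynomial.C c * γ j) :
    ∃ y : Fin 3 → ℂ, (a • L + (b - c * d) • 1) ^ (d * e) *ᵥ y ≠ 0 ∧
      (a • L + (b - c * d) • 1) ^ (d * e + 1) *ᵥ y = 0 := by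
  set K : Matrix (Fin 3) (Fin 3) ℂ := a • L + (b - c * d) • 1 with hK
  let f : Fin 3 → Polynomial ℂ := fun i => aeval γ (P i)
  -- From `γ' = (L - c) γ`, the equivariance and `J X = d P`, the image curve satisfies `f' = (a L +
  -- b - c d) f`.
  have hf' : ∀ i, Polynomial.derivative (f i) = ∑ l, Polynomial.C (K i l) * f l := by
    intro i
    have h1 := congrArg (aeval γ) (congrFun hE i)
    have h2 := congrArg (aeval γ) (congrFun (jacobian_mulVec_X hP) i)
    simp only [Matrix.mulVec, dotProduct, jacobian, Matrix.of_apply, map_sum, map_mul, aeval_X,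
      Pi.smul_apply, Pi.add_apply, smul_eq_mul, map_add, Matrix.map_apply, algHom_C,
      Polynomial.algebraMap_eq] at h1 h2
    simp only [f]
    rw [derivative_aeval]
    simp only [hγ', mul_sub, Finset.sum_sub_distrib]
    rw [h1]
    have h3 : ∑ j, aeval γ (pderiv j (P i)) * (Polynomial.C c * γ j) =
        Polynomial.C c * ∑ j, aeval γ (pderiv j (P i)) * γ j := by
      rw [Finset.mul_sum]
      exact Finset.sum_congr rfl fun j _ => by ring
    rw [h3, h2]
    simp only [hK, Matrix.add_apply, Matrix.smul_apply, smul_eq_mul, Matrix.one_apply, map_add,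
      map_mul, add_mul, Finset.sum_add_distrib, Finset.mul_sum]
    simp only [mul_ite, mul_zero, map_sub, map_mul, apply_ite Polynomial.C, Polynomial.C_1,
      Polynomial.C_0, ite_mul, zero_mul, Finset.sum_ite_eq, Finset.mem_univ, if_true, mul_assoc]
    ring
  have hiter : ∀ k i, Polynomial.derivative^[k] (f i) = ∑ l, Polynomial.C ((K ^ k) i l) * f l := by
    intro k
    induction k with
    | zero =>
      intro i
      simp [Matrix.one_apply]
    | succ k ih =>
      intro i
      rw [Function.iterate_succ_apply', ih, Polynomial.derivative_sum]
      simp only [Polynomial.derivative_C_mul, hf', pow_succ, Matrix.mul_apply, map_sum, map_mul,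
        Finset.mul_sum, Finset.sum_mul, mul_assoc]
      exact Finset.sum_comm
  have hev : ∀ k i, (Polynomial.derivative^[k] (f i)).coeff 0 =
      (K ^ k *ᵥ fun l => (f l).coeff 0) i := by
    intro k i
    rw [hiter, Polynomial.finsetSum_coeff]
    simp [Matrix.mulVec, dotProduct]
  -- For `y = f(0)`, `K ^ k y` is the `k`-th derivative of `f` at `0`. The curve has degree exactly
  -- `d * e`, since its top coefficient is `P` at the top coefficient of `γ`, which is not a zero of
  -- `P`.
  refine ⟨fun l => (f l).coeff 0, fun h => hγ0 (h0 _ (funext fun i => ?_)), funext fun i => ?_⟩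
  · have h1 := congrFun h i
    rw [← hev, Polynomial.coeff_iterate_derivative, zero_add, Nat.descFactorial_self, nsmul_eq_mul,
      Pi.zero_apply, mul_eq_zero, or_iff_right (by exact_mod_cast (Nat.factorial_ne_zero _)),
      (natDegree_aeval_le_and_coeff hγ (hP i)).2] at h1
    exact h1
  · rw [← hev, Polynomial.coeff_iterate_derivative, zero_add, Polynomial.coeff_eq_zero_of_natDegree_lt
      (Nat.lt_succ_of_le (natDegree_aeval_le_and_coeff hγ (hP i)).1), smul_zero]
    rfl

theorem nilpotency_le {K : Matrix (Fin 3) (Fin 3) ℂ} {y : Fin 3 → ℂ} {n : ℕ}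
    (h1 : K ^ n *ᵥ y ≠ 0) (h2 : K ^ (n + 1) *ᵥ y = 0) : n ≤ 2 := by
  by_contra! hn
  have h3 := Module.End.ker_pow_le_ker_pow_finrank (Matrix.toLin' K) (n + 1)
  have h4 : (Matrix.toLin' K ^ 3) y = 0 := by
    have := h3 (x := y) (by rw [LinearMap.mem_ker, ← Matrix.toLin'_pow, Matrix.toLin'_apply, h2])
    simpa using this
  rw [← Matrix.toLin'_pow, Matrix.toLin'_apply] at h4
  apply h1
  rw [← Nat.sub_add_cancel hn, pow_add, ← Matrix.mulVec_mulVec, h4, Matrix.mulVec_zero]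

/-- The vectors `y`, `K y`, `K ^ 2 y` are independent, so Cayley–Hamilton applied to `y` kills all
lower coefficients of the characteristic polynomial. -/
theorem pow_three_eq_zero {K : Matrix (Fin 3) (Fin 3) ℂ} {y : Fin 3 → ℂ}
    (h1 : K ^ 2 *ᵥ y ≠ 0) (h2 : K ^ 3 *ᵥ y = 0) : K ^ 3 = 0 := by
  have hCH := K.aeval_self_charpoly
  have hdeg : K.charpoly.natDegree = 3 := by simp
  have hmon : K.charpoly.coeff 3 = 1 := by
    have := K.charpoly_monic.coeff_natDegree
    rwa [hdeg] at this
  rw [Polynomial.aeval_eq_sum_range, hdeg] at hCH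
  simp only [Finset.sum_range_succ, Finset.sum_range_zero, zero_add, hmon, pow_zero, pow_one,
    one_smul] at hCH
  set c0 := K.charpoly.coeff 0
  set c1 := K.charpoly.coeff 1
  set c2 := K.charpoly.coeff 2
  have hy : c0 • y + c1 • (K *ᵥ y) + c2 • (K ^ 2 *ᵥ y) = 0 := by
    have := congrArg (· *ᵥ y) hCH
    simpa [Matrix.add_mulVec, Matrix.smul_mulVec, h2] using this
  have h3 : K ^ 4 *ᵥ y = 0 := by
    rw [pow_succ', ← Matrix.mulVec_mulVec, h2, Matrix.mulVec_zero]
  have hc0 : c0 = 0 := by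
    have := congrArg (K ^ 2 *ᵥ ·) hy
    simp only [Matrix.mulVec_add, Matrix.mulVec_smul, Matrix.mulVec_mulVec, Matrix.mulVec_zero,
      ← pow_succ, ← pow_add, h2, Nat.reduceAdd, h3, smul_zero, add_zero] at this
    exact (smul_eq_zero.1 this).resolve_right h1
  have hc1 : c1 = 0 := by
    have := congrArg (K *ᵥ ·) hy
    simp only [hc0, zero_smul, zero_add, Matrix.mulVec_add, Matrix.mulVec_smul,
      Matrix.mulVec_mulVec, Matrix.mulVec_zero, ← pow_two, ← pow_succ', Nat.reduceAdd, h2,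
      smul_zero, add_zero] at this
    exact (smul_eq_zero.1 this).resolve_right h1
  have hc2 : c2 = 0 := by
    simp only [hc0, hc1, zero_smul, zero_add] at hy
    exact (smul_eq_zero.1 hy).resolve_right h1
  simpa [hc0, hc1, hc2] using hCH

/-- The linear vector field of an invariant foliation is semisimple. -/
theorem semisimple_of_equivariance {P : Fin 3 → Poly} {d : ℕ} (hd : 2 ≤ d)
    (hP : ∀ i, (P i).IsHomogeneous d) (h0 : NoCommonZero P) {L : Matrix (Fin 3) (Fin 3) ℂ} {a b : ℂ}
    (ha : a ≠ 0)
    (hE : jacobian P *ᵥ (L.map C *ᵥ X) = (C a : Poly) • (L.map C *ᵥ P) + (C b : Poly) • P)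
    (c : ℂ) (w v : Fin 3 → ℂ) (hw : L *ᵥ w = c • w + v) (hv : L *ᵥ v = c • v) : v = 0 := by
  by_contra hv0
  set K : Matrix (Fin 3) (Fin 3) ℂ := a • L + (b - c * d) • 1 with hK
  have hKv : ∀ x, K *ᵥ x = a • (L *ᵥ x) + (b - c * d) • x := by
    intro x
    rw [hK, Matrix.add_mulVec, Matrix.smul_mulVec, Matrix.smul_mulVec, Matrix.one_mulVec]
  -- A Jordan chain gives the integral curve `w + t v` of `L - c`. Its image has degree `d`, which a
  -- nilpotent chain in dimension three bounds by `2`.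
  obtain ⟨y, hy1, hy2⟩ := exists_nilpotent_vector hP h0 hE (c := c) (e := 1)
    (γ := fun j => Polynomial.C (w j) + Polynomial.C (v j) * Polynomial.X)
    (fun j => by compute_degree) (by simpa using hv0) (by
      intro j
      have h1 := congrFun hw j
      have h2 := congrFun hv j
      simp only [Matrix.mulVec, dotProduct, Pi.add_apply, Pi.smul_apply, smul_eq_mul] at h1 h2
      have e1 := congrArg Polynomial.C h1
      have e2 := congrArg Polynomial.C h2
      simp only [map_sum, map_mul, map_add] at e1 e2
      simp only [mul_add, Finset.sum_add_distrib, ← mul_assoc, ← Finset.sum_mul, e1, e2]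
      simp)
  rw [← hK, mul_one] at hy1 hy2
  obtain rfl : d = 2 := le_antisymm (nilpotency_le hy1 hy2) hd
  have hK3 := pow_three_eq_zero hy1 hy2
  have hKeig : K *ᵥ v = (a * c + (b - c * (2 : ℕ))) • v := by
    rw [hKv, hv, smul_smul, ← add_smul]
  have hβ : a * c + (b - c * (2 : ℕ)) = 0 := by
    have h3 : K ^ 3 *ᵥ v = (a * c + (b - c * (2 : ℕ))) ^ 3 • v := by
      rw [pow_succ, pow_two, ← Matrix.mulVec_mulVec, ← Matrix.mulVec_mulVec]
      simp only [hKeig, Matrix.mulVec_smul, smul_smul]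
      congr 1
      ring
    rw [hK3, Matrix.zero_mulVec] at h3
    exact pow_eq_zero_iff (three_ne_zero) |>.1 ((smul_eq_zero.1 h3.symm).resolve_right hv0)
  have hN : ∀ x, L *ᵥ x = c • x + a⁻¹ • (K *ᵥ x) := by
    intro x
    rw [hKv, show b - c * (2 : ℕ) = -(a * c) by linear_combination hβ, smul_add, smul_smul,
      smul_smul, inv_mul_cancel₀ ha, one_smul, mul_neg, inv_mul_cancel_left₀ ha, neg_smul]
    abel
  -- When `d = 2`, `L - c = a⁻¹ K` is nilpotent with `K ^ 2 y ≠ 0`, so `exp (t a⁻¹ K) y` is an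
  -- integral curve of degree `2`; its image has degree `4`, which is impossible.
  obtain ⟨z, hz1, hz2⟩ := exists_nilpotent_vector hP h0 hE (c := c) (e := 2)
    (γ := fun j => Polynomial.C (y j) + Polynomial.C ((a⁻¹ • (K *ᵥ y)) j) * Polynomial.X
      + Polynomial.C (((2⁻¹ : ℂ) • a⁻¹ • a⁻¹ • (K ^ 2 *ᵥ y)) j) * Polynomial.X ^ 2)
    (fun j => by compute_degree) (by
      intro h
      apply hy1
      funext j
      have := congrFun h j
      simp only [Polynomial.coeff_add, Polynomial.coeff_C_mul, Polynomial.coeff_X_pow,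
        Polynomial.coeff_X, Polynomial.coeff_C] at this
      simpa [ha] using this) (by
      intro j
      have h1 := congrFun (hN y) j
      have h2 := congrFun (hN (a⁻¹ • (K *ᵥ y))) j
      have h3 := congrFun (hN ((2⁻¹ : ℂ) • a⁻¹ • a⁻¹ • (K ^ 2 *ᵥ y))) j
      have h4 : K *ᵥ ((2⁻¹ : ℂ) • a⁻¹ • a⁻¹ • (K ^ 2 *ᵥ y)) = 0 := by
        rw [Matrix.mulVec_smul, Matrix.mulVec_smul, Matrix.mulVec_smul, Matrix.mulVec_mulVec,
          ← pow_succ', hK3, Matrix.zero_mulVec]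
        simp
      have h5 : a⁻¹ • (K *ᵥ (a⁻¹ • (K *ᵥ y))) =
          (2 : ℂ) • ((2⁻¹ : ℂ) • a⁻¹ • a⁻¹ • (K ^ 2 *ᵥ y)) := by
        rw [Matrix.mulVec_smul, Matrix.mulVec_mulVec, ← pow_two, smul_smul (2 : ℂ),
          mul_inv_cancel₀ two_ne_zero, one_smul]
      rw [h4] at h3
      rw [h5] at h2
      generalize (2⁻¹ : ℂ) • a⁻¹ • a⁻¹ • (K ^ 2 *ᵥ y) = r at *
      generalize a⁻¹ • (K *ᵥ y) = q at *
      simp only [Matrix.mulVec, dotProduct, Pi.add_apply, Pi.smul_apply, smul_eq_mul] at h1 h2 h3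
      have e1 := congrArg Polynomial.C h1
      have e2 := congrArg Polynomial.C h2
      have e3 := congrArg Polynomial.C h3
      simp only [map_sum, map_mul, map_add, map_ofNat] at e1 e2 e3
      simp only [mul_add, Finset.sum_add_distrib, ← mul_assoc, ← Finset.sum_mul, e1, e2, e3]
      simp
      ring)
  have := nilpotency_le hz1 hz2
  omega

/-! ### Diagonalization and changes of coordinates -/

/-- The linear vector field `L` becomes diagonal in the coordinates `M v`. -/
def Diagonalizes (M : GL (Fin 3) ℂ) (L : Matrix (Fin 3) (Fin 3) ℂ) (lam : Fin 3 → ℂ) : Prop :=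
  (M : Matrix (Fin 3) (Fin 3) ℂ) * L = Matrix.diagonal lam * M

/-- `hss` excludes Jordan chains of length two, so the eigenvectors span; `hprop` makes the
eigenvalues of a basis of eigenvectors distinct. `M` is the inverse of the matrix whose columns are
that basis. -/
theorem exists_diagonalization {L : Matrix (Fin 3) (Fin 3) ℂ}
    (hprop : ∀ (c : ℂ) (v w : Fin 3 → ℂ), v ≠ 0 → L *ᵥ v = c • v → L *ᵥ w = c • w →
      ∃ t : ℂ, w = t • v)
    (hss : ∀ (c : ℂ) (w v : Fin 3 → ℂ), L *ᵥ w = c • w + v → L *ᵥ v = c • v → v = 0) :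
    ∃ (M : GL (Fin 3) ℂ) (lam : Fin 3 → ℂ), Function.Injective lam ∧ Diagonalizes M L lam := by
  set f : Module.End ℂ (Fin 3 → ℂ) := Matrix.toLin' L with hf
  let E : Set (Fin 3 → ℂ) := {x | ∃ c : ℂ, L *ᵥ x = c • x}
  have hgen : ∀ c : ℂ, ∀ k : ℕ, ∀ x, ((f - algebraMap ℂ _ c) ^ k) x = 0 → L *ᵥ x = c • x := by
    intro c k
    have happ : ∀ x, (f - algebraMap ℂ (Module.End ℂ (Fin 3 → ℂ)) c) x = L *ᵥ x - c • x := by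
      intro x
      rw [LinearMap.sub_apply, Module.algebraMap_end_apply, hf, Matrix.toLin'_apply]
    induction k with
    | zero =>
      intro x hx
      rw [pow_zero, Module.End.one_apply] at hx
      simp [hx]
    | succ k ih =>
      intro x hx
      rw [pow_succ, Module.End.mul_apply] at hx
      have h1 := ih _ hx
      rw [happ] at h1
      have h2 := hss c x (L *ᵥ x - c • x) (by abel) h1
      exact sub_eq_zero.1 h2
  have hspan : Submodule.span ℂ E = ⊤ := by
    rw [eq_top_iff, ← Module.End.iSup_maxGenEigenspace_eq_top f]
    refine iSup_le fun c x hx => ?_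
    rw [Module.End.mem_maxGenEigenspace] at hx
    obtain ⟨k, hk⟩ := hx
    exact Submodule.subset_span ⟨c, hgen c k x hk⟩
  obtain ⟨B, hBE, hBspan, hBind⟩ := exists_linearIndependent ℂ E
  have hBtop : ⊤ ≤ Submodule.span ℂ (Set.range ((↑) : B → Fin 3 → ℂ)) := by
    rw [Subtype.range_coe, hBspan, hspan]
  let β := (Module.Basis.mk hBind hBtop)
  let β' : Module.Basis (Fin 3) ℂ (Fin 3 → ℂ) := β.reindex (β.indexEquiv (Pi.basisFun ℂ (Fin 3)))
  have hβE : ∀ i, β' i ∈ E := by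
    intro i
    simp only [β', β, Module.Basis.reindex_apply, Module.Basis.mk_apply]
    exact hBE (Subtype.coe_prop _)
  choose lam hlam using hβE
  have hinj : Function.Injective lam := by
    intro i j hij
    by_contra hne
    obtain ⟨t, ht⟩ := hprop (lam i) (β' i) (β' j) (β'.ne_zero i) (hlam i) (hij ▸ hlam j)
    have := congrArg (fun x => β'.repr x j) ht
    simp [hne] at this
  let Q : Matrix (Fin 3) (Fin 3) ℂ := Matrix.of fun i j => β' j i
  have hQ : IsUnit Q := by
    rw [← Matrix.linearIndependent_cols_iff_isUnit]
    exact β'.linearIndependent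
  have hLQ : L * Q = Q * Matrix.diagonal lam := by
    ext i j
    rw [Matrix.mul_diagonal]
    have := congrFun (hlam j) i
    simp only [Matrix.mulVec, dotProduct, Pi.smul_apply, smul_eq_mul] at this
    rw [Matrix.mul_apply]
    simpa [Q, mul_comm] using this
  refine ⟨hQ.unit⁻¹, lam, hinj, ?_⟩
  have h1 : ((hQ.unit⁻¹ : GL (Fin 3) ℂ) : Matrix (Fin 3) (Fin 3) ℂ) * Q = 1 := hQ.val_inv_mul
  have h2 : Q * ((hQ.unit⁻¹ : GL (Fin 3) ℂ) : Matrix (Fin 3) (Fin 3) ℂ) = 1 := hQ.mul_val_inv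
  calc _ = ((hQ.unit⁻¹ : GL (Fin 3) ℂ) : Matrix (Fin 3) (Fin 3) ℂ) * (L * Q) *
        ((hQ.unit⁻¹ : GL (Fin 3) ℂ) : Matrix (Fin 3) (Fin 3) ℂ) := by
        rw [Matrix.mul_assoc, Matrix.mul_assoc, h2, Matrix.mul_one]
    _ = _ := by rw [hLQ, ← Matrix.mul_assoc, h1, Matrix.one_mul]

theorem coordForms_eq (M : GL (Fin 3) ℂ) :
    coordForms M = (M : Matrix (Fin 3) (Fin 3) ℂ).map C *ᵥ X := rfl

theorem evalMap_coordForms (M : GL (Fin 3) ℂ) (v : Fin 3 → ℂ) :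
    evalMap (coordForms M) v = (M : Matrix (Fin 3) (Fin 3) ℂ) *ᵥ v := by
  rw [coordForms_eq, evalMap_map_C_mulVec, evalMap_X]

theorem mulVec_inv_mulVec (M : GL (Fin 3) ℂ) (v : Fin 3 → ℂ) :
    (M : Matrix (Fin 3) (Fin 3) ℂ) *ᵥ
      (((M⁻¹ : GL (Fin 3) ℂ) : Matrix (Fin 3) (Fin 3) ℂ) *ᵥ v) = v := by
  rw [Matrix.mulVec_mulVec, ← Units.val_mul, mul_inv_cancel, Units.val_one, Matrix.one_mulVec]

theorem inv_mulVec_mulVec (M : GL (Fin 3) ℂ) (v : Fin 3 → ℂ) :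
    ((M⁻¹ : GL (Fin 3) ℂ) : Matrix (Fin 3) (Fin 3) ℂ) *ᵥ
      ((M : Matrix (Fin 3) (Fin 3) ℂ) *ᵥ v) = v := by
  rw [Matrix.mulVec_mulVec, ← Units.val_mul, inv_mul_cancel, Units.val_one, Matrix.one_mulVec]

theorem isGivenBy_conj {φ : P2 → P2} {P : Fin 3 → Poly} (hφ : IsGivenBy φ P) (M : GL (Fin 3) ℂ)
    {Q : Fin 3 → Poly} (hQ : ∀ v, (M : Matrix (Fin 3) (Fin 3) ℂ) *ᵥ
      evalMap P (((M⁻¹ : GL (Fin 3) ℂ) : Matrix (Fin 3) (Fin 3) ℂ) *ᵥ v) = evalMap Q v) :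
    IsGivenBy (coordMap M ∘ φ ∘ coordMap M⁻¹) Q := by
  intro v hv
  have hw : ((M⁻¹ : GL (Fin 3) ℂ) : Matrix (Fin 3) (Fin 3) ℂ) *ᵥ v ≠ 0 := by
    intro h
    apply hv
    rw [← mulVec_inv_mulVec M v, h, Matrix.mulVec_zero]
  obtain ⟨h1, h2⟩ := hφ _ hw
  have h3 : evalMap Q v ≠ 0 := by
    rw [← hQ]
    intro h
    apply h1
    rw [← inv_mulVec_mulVec M (evalMap P _), h, Matrix.mulVec_zero]
  refine ⟨h3, ?_⟩
  have h4 : coordMap M⁻¹ (Projectivization.mk ℂ v hv) = Projectivization.mk ℂ _ hw := rfl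
  rw [Function.comp_apply, Function.comp_apply, h4, h2]
  refine (Projectivization.mk_eq_mk_iff' ℂ _ _ _ _).2 ⟨1, ?_⟩
  rw [one_smul, ← hQ]
  rfl

/-- The polynomial map `M ∘ P ∘ M⁻¹`. -/
def conj (M : GL (Fin 3) ℂ) (P : Fin 3 → Poly) : Fin 3 → Poly :=
  (M : Matrix (Fin 3) (Fin 3) ℂ).map C *ᵥ fun j => bind₁ (coordForms M⁻¹) (P j)

theorem evalMap_conj (M : GL (Fin 3) ℂ) (P : Fin 3 → Poly) (v : Fin 3 → ℂ) :
    (M : Matrix (Fin 3) (Fin 3) ℂ) *ᵥ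
      evalMap P (((M⁻¹ : GL (Fin 3) ℂ) : Matrix (Fin 3) (Fin 3) ℂ) *ᵥ v) =
    evalMap (conj M P) v := by
  rw [conj, evalMap_map_C_mulVec]
  congr 1
  funext j
  rw [evalMap, evalMap, eval_bind₁, evalMap_coordForms]

theorem isHomogeneous_conj (M : GL (Fin 3) ℂ) {P : Fin 3 → Poly} {d : ℕ}
    (hP : ∀ i, (P i).IsHomogeneous d) (i : Fin 3) : (conj M P i).IsHomogeneous d := by
  refine IsHomogeneous.sum _ _ _ fun j _ => IsHomogeneous.C_mul ?_ _
  have h : ∀ j, (coordForms M⁻¹ j).IsHomogeneous 1 := fun j =>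
    IsHomogeneous.sum _ _ _ fun l _ => (isHomogeneous_X ℂ l).C_mul _
  have := (hP j).aeval (coordForms M⁻¹) h
  rwa [one_mul] at this

theorem noCommonZero_conj (M : GL (Fin 3) ℂ) {P : Fin 3 → Poly} (h0 : NoCommonZero P) :
    NoCommonZero (conj M P) := by
  intro v hv
  rw [← evalMap_conj] at hv
  have h1 := congrArg (((M⁻¹ : GL (Fin 3) ℂ) : Matrix (Fin 3) (Fin 3) ℂ) *ᵥ ·) hv
  simp only [inv_mulVec_mulVec, Matrix.mulVec_zero] at h1
  rw [← mulVec_inv_mulVec M v, h0 _ h1, Matrix.mulVec_zero]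

theorem pderiv_bind₁ (Q : Fin 3 → Poly) (f : Poly) (k : Fin 3) :
    pderiv k (bind₁ Q f) = ∑ l, bind₁ Q (pderiv l f) * pderiv k (Q l) := by
  induction f using MvPolynomial.induction_on with
  | C a => simp
  | add p q hp hq => simp [hp, hq, add_mul, Finset.sum_add_distrib]
  | mul_X p i hp =>
    rw [map_mul, pderiv_mul, hp, bind₁_X_right]
    simp only [pderiv_mul, map_add, map_mul, bind₁_X_right, add_mul, Finset.sum_add_distrib]
    congr 1
    · rw [Finset.sum_mul]
      exact Finset.sum_congr rfl fun j _ => by ring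
    · rw [Finset.sum_eq_single i]
      · simp
      · intro j _ hj
        rw [pderiv_X_of_ne hj.symm]
        simp
      · simp

theorem jacobian_map_C_mulVec (L : Matrix (Fin 3) (Fin 3) ℂ) (V : Fin 3 → Poly) :
    jacobian (L.map C *ᵥ V) = L.map C * jacobian V := by
  ext1 i j
  simp [jacobian, Matrix.mulVec, dotProduct, Matrix.mul_apply]

theorem jacobian_X : jacobian (X : Fin 3 → Poly) = 1 := by
  ext1 i j
  simp only [jacobian, Matrix.of_apply, Matrix.one_apply]
  split_ifs with h
  · rw [h, pderiv_X_self]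
  · rw [pderiv_X_of_ne h]

theorem jacobian_coordForms (M : GL (Fin 3) ℂ) :
    jacobian (coordForms M) = (M : Matrix (Fin 3) (Fin 3) ℂ).map C := by
  rw [coordForms_eq, jacobian_map_C_mulVec, jacobian_X, Matrix.mul_one]

theorem map_C_mulVec_map_C_mulVec (A B : Matrix (Fin 3) (Fin 3) ℂ) (V : Fin 3 → Poly) :
    A.map C *ᵥ (B.map C *ᵥ V) = (A * B).map C *ᵥ V := by
  rw [Matrix.mulVec_mulVec, Matrix.map_mul]

theorem jacobian_conj_mulVec (M : GL (Fin 3) ℂ) (P V : Fin 3 → Poly) :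
    jacobian (conj M P) *ᵥ ((M : Matrix (Fin 3) (Fin 3) ℂ).map C *ᵥ
      fun j => bind₁ (coordForms M⁻¹) (V j)) =
    (M : Matrix (Fin 3) (Fin 3) ℂ).map C *ᵥ
      fun j => bind₁ (coordForms M⁻¹) ((jacobian P *ᵥ V) j) := by
  have h1 : jacobian (fun j => bind₁ (coordForms M⁻¹) (P j)) =
      (jacobian P).map (bind₁ (coordForms M⁻¹)) *
        ((M⁻¹ : GL (Fin 3) ℂ) : Matrix (Fin 3) (Fin 3) ℂ).map C := by
    rw [← jacobian_coordForms]
    ext1 i j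
    simp only [jacobian, Matrix.of_apply, pderiv_bind₁, Matrix.mul_apply, Matrix.map_apply]
  rw [conj, jacobian_map_C_mulVec, h1, ← Matrix.mulVec_mulVec, ← Matrix.mulVec_mulVec,
    map_C_mulVec_map_C_mulVec, ← Units.val_mul, inv_mul_cancel, Units.val_one, Matrix.map_one _ C_0 C_1, Matrix.one_mulVec]
  congr 1
  funext i
  simp [Matrix.mulVec, dotProduct]

theorem bind₁_coordForms_ne_zero (M : GL (Fin 3) ℂ) {g : Poly} (hg : g ≠ 0) :
    bind₁ (coordForms M) g ≠ 0 := by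
  intro h
  refine hg (MvPolynomial.funext fun v => ?_)
  have := congrArg (eval (((M⁻¹ : GL (Fin 3) ℂ) : Matrix (Fin 3) (Fin 3) ℂ) *ᵥ v)) h
  rwa [eval_bind₁, evalMap_coordForms, mulVec_inv_mulVec, map_zero] at this

/-- A multiple of the form annihilated by the radial vector field and by the image under `M` of
the vector field `V` induces the foliation tangent to `V`. -/
theorem induces_of_vectorField (F : Foliation) {V W : Fin 3 → Poly} (hV : F.form = X ⨯₃ V)
    (M : GL (Fin 3) ℂ) (hW : (fun i => bind₁ (coordForms M) (W i)) =
      (M : Matrix (Fin 3) (Fin 3) ℂ).map C *ᵥ V) {g : Poly} (hg : g ≠ 0) {B : OneForm}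
    (hB : B = g • (X ⨯₃ W)) : Induces (pullback (coordForms M) B) F := by
  set N := (M : Matrix (Fin 3) (Fin 3) ℂ).map (C : ℂ → Poly) with hN
  have hdet : N.det = C (M : Matrix (Fin 3) (Fin 3) ℂ).det :=
    ((C : ℂ →+* Poly).map_det _).symm
  have hdet0 : N.det ≠ 0 := by
    rw [hdet, ne_eq, C_eq_zero]
    exact ((Matrix.isUnit_iff_isUnit_det _).1 M.isUnit).ne_zero
  refine ⟨bind₁ (coordForms M) g * N.det, mul_ne_zero (bind₁_coordForms_ne_zero M hg) hdet0, ?_⟩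
  have h1 : (fun i => bind₁ (coordForms M) (B i)) =
      bind₁ (coordForms M) g • ((N *ᵥ X) ⨯₃ (N *ᵥ V)) := by
    have h2 : (fun i => bind₁ (coordForms M) (X i)) = N *ᵥ X := by
      simp only [bind₁_X_right]; rfl
    rw [← hW, ← h2, ← bind₁_cross, hB]
    funext i
    simp
  rw [pullback_eq_vecMul, h1, jacobian_coordForms, mulVec_cross_mulVec, Matrix.smul_vecMul,
    Matrix.vecMul_vecMul, Matrix.adjugate_mul, Matrix.vecMul_smul, Matrix.vecMul_one, ← hV]
  intro i
  simp [mul_assoc]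

theorem induces_of_diagonalizes (F : Foliation) {L : Matrix (Fin 3) (Fin 3) ℂ}
    (hL : F.form = X ⨯₃ (L.map C *ᵥ X)) {M : GL (Fin 3) ℂ} {lam : Fin 3 → ℂ}
    (hM : Diagonalizes M L lam) {g : Poly} (hg : g ≠ 0) {B : OneForm}
    (hB : B = g • (X ⨯₃ ((Matrix.diagonal lam).map C *ᵥ X))) :
    Induces (pullback (coordForms M) B) F := by
  refine induces_of_vectorField F hL M ?_ hg hB
  rw [bind₁_map_C_mulVec]
  simp only [bind₁_X_right]
  rw [map_C_mulVec_map_C_mulVec, hM, ← map_C_mulVec_map_C_mulVec]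
  rfl

theorem equivariance_conj {L : Matrix (Fin 3) (Fin 3) ℂ} {P : Fin 3 → Poly} {a b : ℂ}
    (hE : jacobian P *ᵥ (L.map C *ᵥ X) = (C a : Poly) • (L.map C *ᵥ P) + (C b : Poly) • P)
    {M : GL (Fin 3) ℂ} {lam : Fin 3 → ℂ} (hM : Diagonalizes M L lam) :
    jacobian (conj M P) *ᵥ ((Matrix.diagonal lam).map C *ᵥ X) =
      (C a : Poly) • ((Matrix.diagonal lam).map C *ᵥ conj M P) + (C b : Poly) • conj M P := by
  have h1 := jacobian_conj_mulVec M P (L.map C *ᵥ X)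
  rw [hE, bind₁_map_C_mulVec] at h1
  simp only [bind₁_X_right] at h1
  rw [map_C_mulVec_map_C_mulVec, hM, ← map_C_mulVec_map_C_mulVec,
    show (fun i => coordForms M⁻¹ i) = _ from coordForms_eq M⁻¹, map_C_mulVec_map_C_mulVec _ _ X, ← Units.val_mul, mul_inv_cancel,
    Units.val_one, Matrix.map_one _ C_0 C_1, Matrix.one_mulVec] at h1
  rw [h1]
  have h2 : (fun j => bind₁ (coordForms M⁻¹)
      (((C a : Poly) • (L.map C *ᵥ P) + (C b : Poly) • P) j)) =
      (C a : Poly) • (L.map C *ᵥ fun j => bind₁ (coordForms M⁻¹) (P j)) +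
        (C b : Poly) • fun j => bind₁ (coordForms M⁻¹) (P j) := by
    rw [← bind₁_map_C_mulVec]
    funext j
    simp
  rw [h2, Matrix.mulVec_add, Matrix.mulVec_smul, Matrix.mulVec_smul,
    map_C_mulVec_map_C_mulVec, hM, ← map_C_mulVec_map_C_mulVec]
  rfl

/-! ### Weights of monomials -/

theorem coeff_X_mul_pderiv (f : Poly) (j : Fin 3) (u : Fin 3 →₀ ℕ) :
    coeff u (X j * pderiv j f) = u j * coeff u f := by
  induction f using MvPolynomial.induction_on' with
  | monomial m r =>
    rw [X_mul_pderiv_monomial, coeff_smul, coeff_monomial]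
    split_ifs with h
    · rw [h, nsmul_eq_mul]
    · simp
  | add p q hp hq => simp only [map_add, mul_add, coeff_add, hp, hq]

/-- The components of a map commuting with a diagonal vector field are sums of monomials of
a given weight. -/
theorem weight_eq {lam : Fin 3 → ℂ} {Q : Fin 3 → Poly} {a b : ℂ}
    (hE : jacobian Q *ᵥ ((Matrix.diagonal lam).map C *ᵥ X) =
      (C a : Poly) • ((Matrix.diagonal lam).map C *ᵥ Q) + (C b : Poly) • Q)
    {i : Fin 3} {u : Fin 3 →₀ ℕ} (hu : coeff u (Q i) ≠ 0) :
    ∑ j, u j * lam j = a * lam i + b := by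
  have h1 := congrArg (coeff u) (congrFun hE i)
  have hdiag : ∀ (V : Fin 3 → Poly) j, ((Matrix.diagonal lam).map C *ᵥ V) j = C (lam j) * V j := by
    intro V j
    rw [Matrix.diagonal_map C_0, Matrix.mulVec_diagonal]
  have h2 : (jacobian Q *ᵥ ((Matrix.diagonal lam).map C *ᵥ X)) i =
      ∑ j, C (lam j) * (X j * pderiv j (Q i)) := by
    rw [Matrix.mulVec, dotProduct]
    exact Finset.sum_congr rfl fun j _ => by rw [hdiag, jacobian, Matrix.of_apply]; ring
  rw [h2, coeff_sum, Pi.add_apply, Pi.smul_apply, Pi.smul_apply, hdiag, coeff_add, smul_eq_mul,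
    smul_eq_mul, coeff_C_mul, coeff_C_mul, coeff_C_mul] at h1
  simp only [coeff_C_mul, coeff_X_mul_pderiv] at h1
  apply mul_right_cancel₀ hu
  simp only [Fin.sum_univ_three] at h1 ⊢
  linear_combination h1

theorem eval_single_of_isHomogeneous {f : Poly} {d : ℕ} (hf : f.IsHomogeneous d) (j : Fin 3) :
    eval (Pi.single j 1) f = coeff (Finsupp.single j d) f := by
  rw [eval_eq', Finset.sum_eq_single (Finsupp.single j d)]
  · rw [Finset.prod_eq_one, mul_one]
    intro i _
    by_cases h : i = j
    · subst h; simp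
    · rw [Finsupp.single_eq_of_ne h, pow_zero]
  · intro u hu hne
    obtain ⟨i, hij, hi⟩ : ∃ i, i ≠ j ∧ u i ≠ 0 := by
      by_contra! H
      apply hne
      have h1 : u = Finsupp.single j (u j) := by
        ext i
        by_cases h : i = j
        · subst h; simp
        · rw [Finsupp.single_eq_of_ne h, H i h]
      have h2 : u.degree = d := by
        by_contra h
        exact (mem_support_iff.1 hu) (hf.coeff_eq_zero h)
      rw [h1, Finsupp.degree_single] at h2
      rw [h1, h2]
    rw [Finset.prod_eq_zero (Finset.mem_univ i), mul_zero]
    rw [Pi.single_eq_of_ne hij, zero_pow hi]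
  · intro h
    rw [notMem_support_iff.1 h, zero_mul]

/-- At the vertex `Pi.single j 1` only the monomial `X j ^ d` survives, and `Q` does not vanish
there. -/
theorem exists_coeff_single_ne_zero {Q : Fin 3 → Poly} {d : ℕ} (hQ : ∀ i, (Q i).IsHomogeneous d)
    (h0 : NoCommonZero Q) (j : Fin 3) : ∃ i, coeff (Finsupp.single j d) (Q i) ≠ 0 := by
  by_contra! H
  have h1 : (Pi.single j 1 : Fin 3 → ℂ) = 0 := h0 _ (funext fun i => by
    rw [evalMap, eval_single_of_isHomogeneous (hQ i), H i]; rfl)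
  simpa using congrFun h1 j

theorem eq_C_mul_X_pow {f : Poly} {d : ℕ} (hf : f.IsHomogeneous d) {k : Fin 3}
    (h : ∀ u, coeff u f ≠ 0 → ∀ j, j ≠ k → u j = 0) :
    f = C (coeff (Finsupp.single k d) f) * X k ^ d := by
  have h1 : ∀ u, coeff u f ≠ 0 → u = Finsupp.single k d := by
    intro u hu
    have h1 : u = Finsupp.single k (u k) := by
      ext i
      by_cases hi : i = k
      · subst hi; simp
      · rw [Finsupp.single_eq_of_ne hi, h u hu i hi]
    have h2 : u.degree = d := by
      by_contra h
      exact hu (hf.coeff_eq_zero h)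
    rw [h1, Finsupp.degree_single] at h2
    rw [h1, h2]
  ext u
  rw [coeff_C_mul, coeff_X_pow]
  split_ifs with hu
  · rw [← hu, mul_one]
  · rw [mul_zero]
    by_contra hne
    exact hu (h1 u hne).symm

theorem exists_ofXY_of_pderiv_eq_zero {f : Poly} {d : ℕ} (hf : f.IsHomogeneous d)
    (h : pderiv 2 f = 0) : ∃ g : MvPolynomial (Fin 2) ℂ, g.IsHomogeneous d ∧ ofXY g = f := by
  obtain ⟨g, hg⟩ := exists_rename_eq_of_vars_subset_range f (Fin.castSucc : Fin 2 → Fin 3)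
    (Fin.castSucc_injective 2) (by
      intro i hi
      obtain ⟨u, hu, hiu⟩ := (mem_vars_iff_mem_support i).1 hi
      have h2 : i ≠ 2 := by
        rintro rfl
        have h3 := coeff_X_mul_pderiv f 2 u
        rw [h, mul_zero, coeff_zero, eq_comm, mul_eq_zero, or_iff_left (mem_support_iff.1 hu)] at h3
        exact (Finsupp.mem_support_iff.1 hiu) (by exact_mod_cast h3)
      fin_cases i
      · exact ⟨0, rfl⟩
      · exact ⟨1, rfl⟩
      · exact absurd rfl h2)
  refine ⟨g, ?_, hg⟩
  rw [← hg] at hf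
  exact (IsHomogeneous.rename_isHomogeneous_iff (Fin.castSucc_injective 2)).1 hf

theorem eq_zero_of_dvd_pderiv {f : Poly} {d : ℕ} (hd : 0 < d) (hf : f.IsHomogeneous d)
    (hf0 : f ≠ 0) (k : Fin 3) (h : f ∣ pderiv k f) : pderiv k f = 0 := by
  by_contra hne
  obtain ⟨g, hg⟩ := h
  have hg0 : g ≠ 0 := by
    rintro rfl
    exact hne (by rw [hg, mul_zero])
  have h1 := hf.pderiv (i := k) |>.totalDegree hne
  rw [hg, totalDegree_mul_of_isDomain hf0 hg0, hf.totalDegree hf0] at h1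
  omega

/-! ### Pencils of lines -/

theorem exists_GL_mulVec_eq {u w : Fin 3 → ℂ} (hu : u ≠ 0) (hw : w ≠ 0) :
    ∃ M : GL (Fin 3) ℂ, (M : Matrix (Fin 3) (Fin 3) ℂ) *ᵥ u = w := by
  obtain ⟨A, hA⟩ := SeparatingDual.exists_continuousLinearEquiv_apply_eq (R := ℂ) hu hw
  refine ⟨⟨LinearMap.toMatrix' A.toLinearEquiv.toLinearMap,
    LinearMap.toMatrix' A.toLinearEquiv.symm.toLinearMap, ?_, ?_⟩, ?_⟩
  · rw [← LinearMap.toMatrix'_comp, LinearEquiv.comp_coe, LinearEquiv.symm_trans_self,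
      LinearEquiv.refl_toLinearMap, LinearMap.toMatrix'_id]
  · rw [← LinearMap.toMatrix'_comp, LinearEquiv.comp_coe, LinearEquiv.self_trans_symm,
      LinearEquiv.refl_toLinearMap, LinearMap.toMatrix'_id]
  · rw [← hA]
    exact LinearMap.toMatrix'_mulVec _ _

theorem eq_vec_three {α : Type*} (v : Fin 3 → α) : v = ![v 0, v 1, v 2] := by
  funext i
  fin_cases i <;> rfl

/-- Invariant foliations of degree zero. -/
theorem exists_hasForm_pencil (F : Foliation) {φ : P2 → P2} {P : Fin 3 → Poly} {d : ℕ} (hd : 0 < d)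
    (hP : ∀ i, (P i).IsHomogeneous d) (hφ : IsGivenBy φ P) {h : Poly}
    (hA : ∀ i, pullback P F.form i = h * F.form i) {u : Fin 3 → ℂ} (hu : u ≠ 0)
    (hF : F.form = X ⨯₃ (fun i => C (u i))) :
    ∃ (M : GL (Fin 3) ℂ) (Q R : MvPolynomial (Fin 2) ℂ) (S : Poly),
      Q.IsHomogeneous d ∧ R.IsHomogeneous d ∧ S.IsHomogeneous d ∧
      HasForm F φ M (dQuot (X 0) (X 1)) ![ofXY Q, ofXY R, S] := by
  obtain ⟨M, hM⟩ := exists_GL_mulVec_eq hu (w := ![0, 0, 1])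
    (fun h => by simpa using congrFun h 2)
  set U : Fin 3 → Poly := fun i => C (u i) with hU
  set N := (M : Matrix (Fin 3) (Fin 3) ℂ).map (C : ℂ → Poly) with hN
  have hMU : N *ᵥ U = ![0, 0, 1] := by
    funext i
    have := congrArg (C : ℂ → Poly) (congrFun hM i)
    simp only [Matrix.mulVec, dotProduct, map_sum, map_mul] at this
    simp only [Matrix.mulVec, dotProduct, hN, hU, Matrix.map_apply]
    rw [this]
    fin_cases i <;> simp
  have hbU : ∀ Q : Fin 3 → Poly, (fun i => bind₁ Q (U i)) = U := fun Q => by simp [hU]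
  -- The constant field `U` is tangent to the foliation, hence annihilated by `P^* ω = h ω`.
  have h1 : (P ⨯₃ U) ⬝ᵥ (jacobian P *ᵥ U) = 0 := by
    have h2 : pullback P F.form = h • F.form := funext hA
    rw [pullback_eq_vecMul, hF, bind₁_cross, hbU] at h2
    simp only [bind₁_X_right] at h2
    rw [Matrix.dotProduct_mulVec, h2, smul_dotProduct, dotProduct_comm, dot_cross_self, smul_zero]
  have h2 := jacobian_conj_mulVec M P U
  rw [hbU, ← hN, hMU] at h2
  have h3 : (conj M P ⨯₃ ![0, 0, 1]) ⬝ᵥ (jacobian (conj M P) *ᵥ ![0, 0, 1]) = 0 := by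
    rw [h2, ← hMU, conj, mulVec_cross_mulVec, ← Matrix.dotProduct_mulVec, Matrix.mulVec_mulVec,
      ← hN, Matrix.adjugate_mul, Matrix.smul_mulVec, Matrix.one_mulVec, dotProduct_smul]
    have h4 := congrArg (bind₁ (coordForms M⁻¹)) h1
    rw [dotProduct, map_sum, map_zero] at h4
    simp only [map_mul] at h4
    have h5 := bind₁_cross (coordForms M⁻¹) P U
    rw [hbU] at h5
    rw [← h5, dotProduct, h4, smul_zero]
  -- The ratio of the first two components does not depend on `z`. As they are coprime, each divides
  -- its own `z`-derivative, which has smaller degree and so vanishes.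
  have h4 : conj M P 1 * pderiv 2 (conj M P 0) = conj M P 0 * pderiv 2 (conj M P 1) := by
    simp [cross_apply, dotProduct, Matrix.mulVec, jacobian, Fin.sum_univ_three] at h3
    linear_combination h3
  have hQ := isHomogeneous_conj M hP
  have hQ0 := noCommonZero_conj M hφ.noCommonZero
  have d0 : pderiv 2 (conj M P 0) = 0 := by
    refine eq_zero_of_dvd_pderiv hd (hQ 0) (component_ne_zero hd hQ hQ0 0) 2 ?_
    exact (isRelPrime_component hd hQ hQ0 (by decide : (0 : Fin 3) ≠ 1)).dvd_of_dvd_mul_left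
      ⟨_, h4⟩
  have d1 : pderiv 2 (conj M P 1) = 0 := by
    refine eq_zero_of_dvd_pderiv hd (hQ 1) (component_ne_zero hd hQ hQ0 1) 2 ?_
    exact (isRelPrime_component hd hQ hQ0 (by decide : (1 : Fin 3) ≠ 0)).dvd_of_dvd_mul_left
      ⟨_, h4.symm⟩
  obtain ⟨Q, hQh, hQe⟩ := exists_ofXY_of_pderiv_eq_zero (hQ 0) d0
  obtain ⟨R, hRh, hRe⟩ := exists_ofXY_of_pderiv_eq_zero (hQ 1) d1
  refine ⟨M, Q, R, conj M P 2, hQh, hRh, hQ 2, ?_, ?_⟩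
  · refine induces_of_vectorField F hF M (W := ![0, 0, 1]) ?_ one_ne_zero ?_
    · rw [← hN, hMU]
      funext i
      fin_cases i <;> simp
    · funext i
      fin_cases i <;> simp [dQuot, cross_apply]
  · refine isGivenBy_conj hφ M fun v => ?_
    rw [evalMap_conj, hQe, hRe, ← eq_vec_three]

/-! ### Factorization of the fibred component -/

theorem exists_prod_one_add (f : Polynomial ℂ) (hf : f.coeff 0 ≠ 0) :
    ∃ c : Fin f.natDegree → ℂ, (∀ i, c i ≠ 0) ∧
      ∀ t, f.eval t = f.coeff 0 * ∏ i, (1 + c i * t) := by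
  induction hn : f.natDegree generalizing f with
  | zero =>
    refine ⟨fun _ => 1, fun i => i.elim0, fun t => ?_⟩
    rw [Polynomial.eq_C_of_natDegree_eq_zero hn]
    simp
  | succ n ih =>
    obtain ⟨r, hr⟩ := IsAlgClosed.exists_root f (by
      intro h
      have := Polynomial.natDegree_eq_of_degree_eq_some (n := 0) h
      omega)
    obtain ⟨g, hg⟩ := Polynomial.dvd_iff_isRoot.2 hr
    have hf0 : f ≠ 0 := by
      rintro rfl
      simp at hf
    have hg0 : g ≠ 0 := by
      rintro rfl
      exact hf0 (by rw [hg, mul_zero])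
    have hdeg : g.natDegree = n := by
      rw [hg, Polynomial.natDegree_mul (Polynomial.X_sub_C_ne_zero r) hg0,
        Polynomial.natDegree_X_sub_C] at hn
      omega
    have hc : f.coeff 0 = -r * g.coeff 0 := by
      rw [hg, Polynomial.mul_coeff_zero]
      simp
    have hr0 : r ≠ 0 := by
      rintro rfl
      exact hf (by rw [hc]; simp)
    have hgc : g.coeff 0 ≠ 0 := by
      intro h
      exact hf (by rw [hc, h, mul_zero])
    obtain ⟨c, hc1, hc2⟩ := ih g hgc hdeg
    refine ⟨Fin.cons (-r⁻¹) c, fun i => ?_, fun t => ?_⟩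
    · refine Fin.cases ?_ (fun j => ?_) i
      · simpa using hr0
      · simpa using hc1 j
    · rw [Fin.prod_univ_succ, hc]
      simp only [Fin.cons_zero, Fin.cons_succ]
      conv_lhs => rw [hg]
      rw [Polynomial.eval_mul, hc2 t]
      simp only [Polynomial.eval_sub, Polynomial.eval_X, Polynomial.eval_C]
      field_simp
      ring

theorem eval_fibredPoly (p q δ : ℕ) {l : ℕ} (c : Fin l → ℂ) (v : Fin 3 → ℂ) :
    eval v (fibredPoly p q δ c) =
      v 2 ^ δ * ∏ i, (v 2 ^ (p + q) + c i * (v 0 ^ p * v 1 ^ q)) := by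
  simp [fibredPoly]

/-- A homogeneous polynomial which is a polynomial in `z` and `x ^ p * y ^ q`. -/
theorem exists_eq_fibredPoly {f : Poly} {d p q : ℕ} (hp : 0 < p) (hq : 0 < q)
    (hpq : p.gcd q = 1) (hf : f.IsHomogeneous d)
    (hsupp : ∀ u, coeff u f ≠ 0 → u 0 * q = u 1 * p) (h0 : coeff (Finsupp.single 2 d) f ≠ 0) :
    ∃ (δ l : ℕ) (c : Fin l → ℂ), d = δ + l * (p + q) ∧ (∀ i, c i ≠ 0) ∧
      f = C (coeff (Finsupp.single 2 d) f) * fibredPoly p q δ c := by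
  classical
  have hexp : ∀ u ∈ f.support, u 0 = u 0 / p * p ∧ u 1 = u 0 / p * q ∧
      u 2 + u 0 / p * (p + q) = d := by
    intro u hu
    have h1 := hsupp u (mem_support_iff.1 hu)
    have hdeg : u 0 + u 1 + u 2 = d := by
      have h : u.degree = d := by
        by_contra h
        exact (mem_support_iff.1 hu) (hf.coeff_eq_zero h)
      rwa [Finsupp.degree_eq_sum, Fin.sum_univ_three] at h
    have hdvd : p ∣ u 0 := (Nat.Coprime.dvd_mul_right (n := q) hpq).1 ⟨u 1, by rw [h1, mul_comm]⟩
    obtain ⟨k, hk⟩ := hdvd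
    have hk' : u 0 / p = k := by rw [hk, Nat.mul_div_cancel_left _ hp]
    rw [hk']
    have h2 : u 1 = k * q := by
      rw [hk] at h1
      apply Nat.eq_of_mul_eq_mul_right hp
      rw [← h1]; ring
    refine ⟨by rw [hk, mul_comm], h2, ?_⟩
    rw [← hdeg, hk, h2]; ring
  -- By coprimality the monomials of `f` are `(x ^ p * y ^ q) ^ k * z ^ (d - k * (p + q))`, so `f =
  -- z ^ d * g(x ^ p * y ^ q / z ^ (p + q))`. The roots of `g` give the `c i`, and `δ` is what
  -- remains of the exponent of `z`.
  let g : Polynomial ℂ := ∑ u ∈ f.support, Polynomial.monomial (u 0 / p) (coeff u f)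
  have hg0 : g.coeff 0 = coeff (Finsupp.single 2 d) f := by
    rw [Polynomial.finsetSum_coeff, Finset.sum_eq_single (Finsupp.single 2 d)]
    · simp
    · intro u hu hne
      rw [Polynomial.coeff_monomial, if_neg]
      intro h
      obtain ⟨e0, e1, e2⟩ := hexp u hu
      rw [h] at e0 e1 e2
      apply hne
      ext i
      fin_cases i
      · simpa using e0
      · simpa using e1
      · simpa using e2
    · intro h
      rw [notMem_support_iff.1 h, Polynomial.monomial_zero_right, Polynomial.coeff_zero]
  have hgdeg : g.natDegree * (p + q) ≤ d := by
    have h1 : g.natDegree ≤ d / (p + q) := by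
      refine Polynomial.natDegree_sum_le_of_forall_le _ _ fun u hu => ?_
      refine (Polynomial.natDegree_monomial_le _).trans ?_
      rw [Nat.le_div_iff_mul_le (by omega)]
      have := (hexp u hu).2.2
      omega
    exact (Nat.le_div_iff_mul_le (by omega)).1 h1
  obtain ⟨c, hc1, hc2⟩ := exists_prod_one_add g (by rwa [hg0])
  refine ⟨d - g.natDegree * (p + q), g.natDegree, c, by omega, hc1, ?_⟩
  have key : ∀ v : Fin 3 → ℂ, v 2 ≠ 0 → eval v f =
      eval v (C (coeff (Finsupp.single 2 d) f) * fibredPoly p q (d - g.natDegree * (p + q)) c) := by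
    intro v hv
    have hw : v 2 ^ (p + q) ≠ 0 := pow_ne_zero _ hv
    have h1 : eval v f = v 2 ^ d * g.eval (v 0 ^ p * v 1 ^ q / v 2 ^ (p + q)) := by
      rw [eval_eq', Polynomial.eval_finsetSum, Finset.mul_sum]
      refine Finset.sum_congr rfl fun u hu => ?_
      obtain ⟨e0, e1, e2⟩ := hexp u hu
      rw [Polynomial.eval_monomial, Fin.prod_univ_three]
      generalize u 0 / p = k at *
      rw [e0, e1, ← e2, div_pow, mul_pow, pow_add, ← pow_mul, ← pow_mul, ← pow_mul]
      field_simp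
      ring_nf
    rw [h1, hc2, map_mul, eval_C, eval_fibredPoly, hg0]
    have h2 : ∏ i, (v 2 ^ (p + q) + c i * (v 0 ^ p * v 1 ^ q)) =
        (v 2 ^ (p + q)) ^ g.natDegree *
          ∏ i, (1 + c i * (v 0 ^ p * v 1 ^ q / v 2 ^ (p + q))) := by
      rw [← Fin.prod_const g.natDegree (v 2 ^ (p + q)), ← Finset.prod_mul_distrib]
      refine Finset.prod_congr rfl fun i _ => ?_
      field_simp
    have h3 : v 2 ^ d = v 2 ^ (d - g.natDegree * (p + q)) * v 2 ^ (g.natDegree * (p + q)) := by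
      rw [← pow_add, Nat.sub_add_cancel hgdeg]
    rw [h2, ← pow_mul, mul_comm (p + q), h3]
    ring
  -- The identity `key` holds off `z = 0`; multiplying by `z` makes it hold everywhere.
  apply mul_left_cancel₀ (X_ne_zero (R := ℂ) (2 : Fin 3))
  refine MvPolynomial.funext fun v => ?_
  rw [map_mul, map_mul, eval_X]
  by_cases hv : v 2 = 0
  · rw [hv, zero_mul, zero_mul]
  · rw [key v hv]

theorem eval_fibredPoly_scale (p q δ : ℕ) {l : ℕ} (c : Fin l → ℂ) {s : Fin 3 → ℂ}
    (hs : ∀ i, s i ≠ 0) (v : Fin 3 → ℂ) :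
    eval (fun j => (s j)⁻¹ * v j) (fibredPoly p q δ c) = (s 2)⁻¹ ^ (δ + l * (p + q)) *
      eval v (fibredPoly p q δ fun i => c i * (s 2 ^ (p + q) * ((s 0)⁻¹ ^ p * (s 1)⁻¹ ^ q))) := by
  rw [eval_fibredPoly, eval_fibredPoly]
  have h2 : s 2 ^ (p + q) ≠ 0 := pow_ne_zero _ (hs 2)
  have h1 : ∏ i, (((s 2)⁻¹ * v 2) ^ (p + q) + c i * (((s 0)⁻¹ * v 0) ^ p * ((s 1)⁻¹ * v 1) ^ q)) =
      ((s 2)⁻¹ ^ (p + q)) ^ l * ∏ i, (v 2 ^ (p + q) +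
        c i * (s 2 ^ (p + q) * ((s 0)⁻¹ ^ p * (s 1)⁻¹ ^ q)) * (v 0 ^ p * v 1 ^ q)) := by
    rw [← Fin.prod_const l ((s 2)⁻¹ ^ (p + q)), ← Finset.prod_mul_distrib]
    refine Finset.prod_congr rfl fun i _ => ?_
    have h3 : (s 2)⁻¹ ^ (p + q) * s 2 ^ (p + q) = 1 := by
      rw [← mul_pow, inv_mul_cancel₀ (hs 2), one_pow]
    rw [mul_pow, mul_pow, mul_pow]
    linear_combination (-(c i * (s 0)⁻¹ ^ p * (s 1)⁻¹ ^ q * v 0 ^ p * v 1 ^ q)) * h3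
  rw [h1, mul_pow, pow_add (s 2)⁻¹ δ, mul_comm l, pow_mul (s 2)⁻¹ (p + q) l]
  ring

/-! ### Equivariant lifts in eigencoordinates -/

/-- `P` is a lift of `φ` of degree `d`, the foliation `F` is tangent to the linear vector field `L`,
and `P` sends `L` to `a L + b` times the radial vector field. -/
structure EquivariantLift (F : Foliation) (φ : P2 → P2) (P : Fin 3 → Poly) (d : ℕ)
    (L : Matrix (Fin 3) (Fin 3) ℂ) (a b : ℂ) : Prop where
  two_le : 2 ≤ d
  homogeneous : ∀ i, (P i).IsHomogeneous d
  isGivenBy : IsGivenBy φ P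
  form_eq : F.form = X ⨯₃ (L.map C *ᵥ X)
  ne_zero : a ≠ 0
  equivariant : jacobian P *ᵥ (L.map C *ᵥ X) =
    (C a : Poly) • (L.map C *ᵥ P) + (C b : Poly) • P

theorem Diagonalizes.exists_comp_perm {M : GL (Fin 3) ℂ} {L : Matrix (Fin 3) (Fin 3) ℂ}
    {lam : Fin 3 → ℂ} (hM : Diagonalizes M L lam) (τ : Equiv.Perm (Fin 3)) :
    ∃ M' : GL (Fin 3) ℂ, Diagonalizes M' L (lam ∘ τ) := by
  have hdet : ((M : Matrix (Fin 3) (Fin 3) ℂ).submatrix τ id).det ≠ 0 := by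
    rw [Matrix.det_permute]
    refine mul_ne_zero ?_ ((Matrix.isUnit_iff_isUnit_det _).1 M.isUnit).ne_zero
    rcases Int.units_eq_one_or (Equiv.Perm.sign τ) with h | h <;> simp [h]
  refine ⟨Matrix.GeneralLinearGroup.mkOfDetNeZero _ hdet, ?_⟩
  ext i j
  have h1 := congrFun (congrFun hM (τ i)) j
  rw [Matrix.diagonal_mul] at h1 ⊢
  exact h1

/-- The diagonal change of coordinates with coefficients `s`. -/
def diagGL (s : Fin 3 → ℂ) (hs : ∀ i, s i ≠ 0) : GL (Fin 3) ℂ where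
  val := Matrix.diagonal s
  inv := Matrix.diagonal fun i => (s i)⁻¹
  val_inv := by
    rw [Matrix.diagonal_mul_diagonal, ← Matrix.diagonal_one]
    congr 1
    funext i
    exact mul_inv_cancel₀ (hs i)
  inv_val := by
    rw [Matrix.diagonal_mul_diagonal, ← Matrix.diagonal_one]
    congr 1
    funext i
    exact inv_mul_cancel₀ (hs i)

theorem Diagonalizes.diagGL_mul {M : GL (Fin 3) ℂ} {L : Matrix (Fin 3) (Fin 3) ℂ}
    {lam : Fin 3 → ℂ} (hM : Diagonalizes M L lam) (s : Fin 3 → ℂ) (hs : ∀ i, s i ≠ 0) :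
    Diagonalizes (diagGL s hs * M) L lam := by
  have h1 : ((diagGL s hs * M : GL (Fin 3) ℂ) : Matrix (Fin 3) (Fin 3) ℂ) =
      Matrix.diagonal s * M := rfl
  rw [Diagonalizes, h1, Matrix.mul_assoc, hM, ← Matrix.mul_assoc, ← Matrix.mul_assoc,
    Matrix.diagonal_mul_diagonal, Matrix.diagonal_mul_diagonal]
  simp only [mul_comm]

namespace EquivariantLift

variable {F : Foliation} {φ : P2 → P2} {P : Fin 3 → Poly} {d : ℕ}
  {L : Matrix (Fin 3) (Fin 3) ℂ} {a b : ℂ} {M : GL (Fin 3) ℂ} {lam : Fin 3 → ℂ}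

/-- Diagonal matrices commute with the diagonalized field, so the coordinates may be rescaled by `s`
to normalize coefficients of the map without changing the form. -/
theorem hasForm_diagGL_mul (H : EquivariantLift F φ P d L a b) (hM : Diagonalizes M L lam)
    {s : Fin 3 → ℂ} (hs : ∀ i, s i ≠ 0) {g : Poly} (hg : g ≠ 0) {B : OneForm}
    (hB : B = g • (X ⨯₃ ((Matrix.diagonal lam).map C *ᵥ X))) {Q : Fin 3 → Poly}
    (hQ : ∀ v i, s i * eval (fun j => (s j)⁻¹ * v j) (conj M P i) = eval v (Q i)) :
    HasForm F φ (diagGL s hs * M) B Q := by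
  refine ⟨induces_of_diagonalizes F H.form_eq (hM.diagGL_mul s hs) hg hB,
    isGivenBy_conj H.isGivenBy _ fun v => ?_⟩
  have h1 : (((diagGL s hs * M)⁻¹ : GL (Fin 3) ℂ) : Matrix (Fin 3) (Fin 3) ℂ) =
      ((M⁻¹ : GL (Fin 3) ℂ) : Matrix (Fin 3) (Fin 3) ℂ) * Matrix.diagonal fun i => (s i)⁻¹ := by
    rw [mul_inv_rev]
    rfl
  have h2 : ((diagGL s hs * M : GL (Fin 3) ℂ) : Matrix (Fin 3) (Fin 3) ℂ) =
      Matrix.diagonal s * M := rfl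
  have h3 : (Matrix.diagonal fun i => (s i)⁻¹) *ᵥ v = fun j => (s j)⁻¹ * v j := by
    funext j
    rw [Matrix.mulVec_diagonal]
  rw [h1, h2, ← Matrix.mulVec_mulVec, ← Matrix.mulVec_mulVec, evalMap_conj, h3]
  funext i
  rw [Matrix.mulVec_diagonal]
  exact hQ v i

theorem weight (H : EquivariantLift F φ P d L a b) (hM : Diagonalizes M L lam) {i : Fin 3}
    {u : Fin 3 →₀ ℕ} (hu : coeff u (conj M P i) ≠ 0) :
    ∑ k, (u k : ℂ) * lam k = a * lam i + b ∧ ∑ k, (u k : ℂ) = d := by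
  refine ⟨weight_eq (equivariance_conj H.equivariant hM) hu, ?_⟩
  have h : u.degree = d := by
    by_contra h
    exact hu ((isHomogeneous_conj M H.homogeneous i).coeff_eq_zero h)
  rw [Finsupp.degree_eq_sum] at h
  exact_mod_cast h

theorem exists_vertex (H : EquivariantLift F φ P d L a b) (hM : Diagonalizes M L lam)
    (j : Fin 3) : ∃ i, coeff (Finsupp.single j d) (conj M P i) ≠ 0 ∧
      d * lam j = a * lam i + b := by
  obtain ⟨i, hi⟩ := exists_coeff_single_ne_zero (isHomogeneous_conj M H.homogeneous)
    (noCommonZero_conj M H.isGivenBy.noCommonZero) j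
  refine ⟨i, hi, ?_⟩
  rw [← (H.weight hM hi).1, Finset.sum_eq_single j]
  · simp
  · intro k _ hk
    rw [Finsupp.single_eq_of_ne hk, Nat.cast_zero, zero_mul]
  · simp

/-- The component containing `X j ^ d` determines `d * lam j`; since the eigenvalues are distinct,
different `j` use different components. -/
theorem exists_perm (H : EquivariantLift F φ P d L a b) (hM : Diagonalizes M L lam)
    (hlam : Function.Injective lam) :
    ∃ σ : Equiv.Perm (Fin 3), ∀ j, d * lam j = a * lam (σ j) + b := by
  have hd : (d : ℂ) ≠ 0 := by
    have := H.two_le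
    exact_mod_cast (by omega : d ≠ 0)
  choose σ _ hσ using H.exists_vertex hM
  have hinj : Function.Injective σ := by
    intro i j hij
    apply hlam
    apply mul_left_cancel₀ hd
    rw [hσ i, hσ j, hij]
  exact ⟨Equiv.ofBijective σ (Finite.injective_iff_bijective.1 hinj), hσ⟩

theorem coeff_vertex_ne_zero (H : EquivariantLift F φ P d L a b) (hM : Diagonalizes M L lam)
    (hlam : Function.Injective lam) {i j : Fin 3} (hij : d * lam j = a * lam i + b) :
    coeff (Finsupp.single j d) (conj M P i) ≠ 0 := by
  obtain ⟨k, hk, hk'⟩ := H.exists_vertex hM j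
  have : k = i := by
    apply hlam
    apply mul_left_cancel₀ H.ne_zero
    linear_combination hij - hk'
  rwa [← this]

/-- If the only monomial of the same weight as `X j ^ d` is this one, then the corresponding
component is a multiple of `X j ^ d`. -/
theorem exists_eq_C_mul_X_pow (H : EquivariantLift F φ P d L a b) (hM : Diagonalizes M L lam)
    (hlam : Function.Injective lam) {i j : Fin 3} (hij : d * lam j = a * lam i + b)
    (hext : ∀ u : Fin 3 → ℕ, ∑ k, (u k : ℂ) * (lam k - lam j) = 0 → ∀ k, k ≠ j → u k = 0) :
    ∃ c : ℂ, c ≠ 0 ∧ conj M P i = C c * X j ^ d := by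
  refine ⟨_, H.coeff_vertex_ne_zero hM hlam hij,
    eq_C_mul_X_pow (isHomogeneous_conj M H.homogeneous i) fun u hu => hext u ?_⟩
  obtain ⟨h1, h2⟩ := H.weight hM hu
  simp only [mul_sub, Finset.sum_sub_distrib, ← Finset.sum_mul]
  rw [h1, h2, hij, sub_self]

end EquivariantLift

/-! ### Components forced to be pure powers -/

/-- After division by `lam 2 - lam 0` the relation has the form `m * r = n` with integers `m`, `n`,
so both vanish; the signs of the `u k` finish the argument. -/
theorem extremal_of_irrational {lam : Fin 3 → ℂ} (hlam : Function.Injective lam) {r : ℂ}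
    (hr : r ∉ Set.range ((↑) : ℚ → ℂ)) (h : lam 1 - lam 2 = r * (lam 2 - lam 0)) (j : Fin 3)
    (u : Fin 3 → ℕ) (hu : ∑ k, (u k : ℂ) * (lam k - lam j) = 0) : ∀ k, k ≠ j → u k = 0 := by
  have hδ : lam 2 - lam 0 ≠ 0 := sub_ne_zero.2 fun h => by simpa using hlam h
  have key : ∀ m n : ℤ, (m : ℂ) * r = n → m = 0 := by
    intro m n hmn
    by_contra hm
    apply hr
    have hm' : (m : ℂ) ≠ 0 := by exact_mod_cast hm
    refine ⟨n / m, ?_⟩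
    push_cast
    rw [← hmn]
    field_simp
  rw [Fin.sum_univ_three] at hu
  fin_cases j
  · have h1 : ((u 1 : ℤ) : ℂ) * r = ((-(u 1 + u 2) : ℤ) : ℂ) := by
      apply mul_right_cancel₀ hδ
      push_cast
      simp at hu
      linear_combination hu - (u 1 : ℂ) * h
    have h2 := key _ _ h1
    rw [h2] at h1
    have h3 : (0 : ℤ) = -(0 + u 2) := by
      have : ((0 : ℤ) : ℂ) = ((-(0 + u 2) : ℤ) : ℂ) := by rw [← h1]; simp
      exact_mod_cast this
    intro k hk
    fin_cases k
    · exact absurd rfl hk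
    · exact_mod_cast h2
    · simp at h3; exact_mod_cast h3
  · have h1 : ((u 0 + u 2 : ℤ) : ℂ) * r = ((-(u 0) : ℤ) : ℂ) := by
      apply mul_right_cancel₀ hδ
      push_cast
      simp at hu
      linear_combination -hu - ((u 0 : ℂ) + u 2) * h
    have h2 := key _ _ h1
    intro k hk
    fin_cases k
    · simp; omega
    · exact absurd rfl hk
    · simp; omega
  · have h1 : ((u 1 : ℤ) : ℂ) * r = ((u 0 : ℤ) : ℂ) := by
      apply mul_right_cancel₀ hδ
      push_cast
      simp at hu
      linear_combination hu - (u 1 : ℂ) * h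
    have h2 := key _ _ h1
    rw [h2, Int.cast_zero, zero_mul] at h1
    intro k hk
    fin_cases k
    · exact_mod_cast h1.symm
    · exact_mod_cast h2
    · exact absurd rfl hk

/-- The three eigenvalues lie on a real line with `lam 2` strictly between the others, so from an
end `lam j` all differences point the same way and no cancellation occurs. -/
theorem extremal_of_between {lam : Fin 3 → ℂ} {p q : ℕ} {κ : ℂ} (hp : 0 < p) (hq : 0 < q)
    (hκ : κ ≠ 0) (h0 : lam 0 - lam 2 = q * κ) (h1 : lam 1 - lam 2 = -(p * κ)) {j : Fin 3}
    (hj : j ≠ 2) (u : Fin 3 → ℕ) (hu : ∑ k, (u k : ℂ) * (lam k - lam j) = 0) :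
    ∀ k, k ≠ j → u k = 0 := by
  rw [Fin.sum_univ_three] at hu
  fin_cases j
  · have h : ((u 1 * (p + q) + u 2 * q : ℕ) : ℂ) = 0 := by
      apply mul_right_cancel₀ hκ
      push_cast
      simp at hu
      linear_combination -hu + (u 1 : ℂ) * h1 - (u 1 + u 2 : ℂ) * h0
    have h' : u 1 * (p + q) + u 2 * q = 0 := by exact_mod_cast h
    have e1 : u 1 = 0 := by nlinarith
    have e2 : u 2 = 0 := by nlinarith
    intro k hk
    fin_cases k
    · exact absurd rfl hk
    · exact e1
    · exact e2
  · have h : ((u 0 * (p + q) + u 2 * p : ℕ) : ℂ) = 0 := by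
      apply mul_right_cancel₀ hκ
      push_cast
      simp at hu
      linear_combination hu - (u 0 : ℂ) * h0 + (u 0 + u 2 : ℂ) * h1
    have h' : u 0 * (p + q) + u 2 * p = 0 := by exact_mod_cast h
    have e1 : u 0 = 0 := by nlinarith
    have e2 : u 2 = 0 := by nlinarith
    intro k hk
    fin_cases k
    · exact e1
    · exact absurd rfl hk
    · exact e2
  · exact absurd rfl hj

/-! ### Closed forms and rescaling constants -/

theorem cross_diagonal (lam : Fin 3 → ℂ) :
    X ⨯₃ ((Matrix.diagonal lam).map C *ᵥ X) = dLog (lam 2 - lam 1) (lam 0 - lam 2) (lam 1 - lam 0) := by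
  rw [Matrix.diagonal_map C_0]
  funext i
  fin_cases i <;>
  · simp [cross_apply, Matrix.mulVec_diagonal, dLog]
    ring

theorem C_smul_dLog (k a b c : ℂ) :
    (C k : Poly) • dLog a b c = dLog (k * a) (k * b) (k * c) := by
  funext i
  fin_cases i <;> simp [dLog, mul_assoc]

theorem dLog_eq_smul_cross {lam : Fin 3 → ℂ} (hlam : Function.Injective lam) {r : ℂ}
    (h : lam 1 - lam 2 = r * (lam 2 - lam 0)) :
    (C (lam 0 - lam 2)⁻¹ : Poly) ≠ 0 ∧ dLog r 1 (-1 - r) =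
      (C (lam 0 - lam 2)⁻¹ : Poly) • (X ⨯₃ ((Matrix.diagonal lam).map C *ᵥ X)) := by
  have hδ : lam 0 - lam 2 ≠ 0 := sub_ne_zero.2 fun h => by simpa using hlam h
  refine ⟨by rw [ne_eq, C_eq_zero]; exact inv_ne_zero hδ, ?_⟩
  have e0 : r = (lam 0 - lam 2)⁻¹ * (lam 2 - lam 1) := by
    field_simp
    linear_combination h
  have e2 : -1 - r = (lam 0 - lam 2)⁻¹ * (lam 1 - lam 0) := by
    field_simp
    linear_combination -h
  have e1 : 1 = (lam 0 - lam 2)⁻¹ * (lam 0 - lam 2) := (inv_mul_cancel₀ hδ).symm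
  rw [cross_diagonal, C_smul_dLog, ← e0, ← e1, ← e2]

/-- Since `D ^ 2 d(N / D) = N D d log (N / D)`, the multiplier is `N D / (x y z)`, up to the
constant `κ⁻¹`. -/
theorem dQuot_eq_smul_cross {lam : Fin 3 → ℂ} {p q : ℕ} {κ : ℂ} (hp : 0 < p) (hq : 0 < q)
    (hκ : κ ≠ 0) (h0 : lam 0 - lam 2 = q * κ) (h1 : lam 1 - lam 2 = -(p * κ)) :
    (C κ⁻¹ * (X 0 ^ (p - 1) * X 1 ^ (q - 1) * X 2 ^ (p + q - 1)) : Poly) ≠ 0 ∧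
    dQuot (X 0 ^ p * X 1 ^ q) (X 2 ^ (p + q)) =
      (C κ⁻¹ * (X 0 ^ (p - 1) * X 1 ^ (q - 1) * X 2 ^ (p + q - 1)) : Poly) •
        (X ⨯₃ ((Matrix.diagonal lam).map C *ᵥ X)) := by
  have hX : ∀ (i : Fin 3) n, (X i ^ n : Poly) ≠ 0 := fun i n => pow_ne_zero _ (X_ne_zero i)
  refine ⟨mul_ne_zero (by rw [ne_eq, C_eq_zero]; exact inv_ne_zero hκ)
    (mul_ne_zero (mul_ne_zero (hX _ _) (hX _ _)) (hX _ _)), ?_⟩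
  obtain ⟨p, rfl⟩ : ∃ k, p = k + 1 := ⟨p - 1, by omega⟩
  obtain ⟨q, rfl⟩ : ∃ k, q = k + 1 := ⟨q - 1, by omega⟩
  have e0 : lam 2 - lam 1 = (p + 1 : ℕ) * κ := by linear_combination -h1
  have e2 : lam 1 - lam 0 = -((p + 1 : ℕ) + (q + 1 : ℕ)) * κ := by linear_combination h1 - h0
  have hC : (C κ⁻¹ : Poly) * C κ = 1 := by rw [← C_mul, inv_mul_cancel₀ hκ, C_1]
  rw [cross_diagonal, e0, h0, e2]
  simp only [Nat.add_sub_cancel, show p + 1 + (q + 1) = p + 1 + q + 1 by omega]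
  funext i
  fin_cases i
  · simp [dQuot, dLog]
    linear_combination (-((p : Poly) + 1) * X 0 ^ p * X 1 ^ (q + 1) * X 2 ^ (p + 1 + q + 1)) * hC
  · simp [dQuot, dLog]
    linear_combination (-((q : Poly) + 1) * X 0 ^ (p + 1) * X 1 ^ q * X 2 ^ (p + 1 + q + 1)) * hC
  · simp [dQuot, dLog]
    linear_combination (((p : Poly) + q + 2) * X 0 ^ (p + 1) * X 1 ^ (q + 1) * X 2 ^ (p + 1 + q)) * hC

theorem scale_pow {s t c x : ℂ} {d : ℕ} (ht : t ≠ 0) (h : s * c = t ^ d) :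
    s * (c * (t⁻¹ * x) ^ d) = x ^ d := by
  rw [← mul_assoc, h, ← mul_pow, mul_inv_cancel_left₀ ht]

theorem exists_scale {c : ℂ} (hc : c ≠ 0) {d : ℕ} (hd : 2 ≤ d) : ∃ s : ℂ, s ≠ 0 ∧ s * c = s ^ d := by
  obtain ⟨s, hs⟩ := IsAlgClosed.exists_pow_nat_eq c (by omega : 0 < d - 1)
  refine ⟨s, ?_, ?_⟩
  · rintro rfl
    rw [zero_pow (by omega)] at hs
    exact hc hs.symm
  · rw [← hs, ← pow_succ', Nat.sub_add_cancel (by omega)]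

/-- Eliminating `s` leaves one equation for `t` with exponent `d * d`; for a three-cycle the
exponent is `d * d * d`. -/
theorem exists_scale_two {c₀ c₁ : ℂ} (h₀ : c₀ ≠ 0) (h₁ : c₁ ≠ 0) {d : ℕ} (hd : 2 ≤ d) :
    ∃ s t : ℂ, s ≠ 0 ∧ t ≠ 0 ∧ s * c₀ = t ^ d ∧ t * c₁ = s ^ d := by
  obtain ⟨t, ht, h⟩ := exists_scale (mul_ne_zero h₁ (pow_ne_zero d h₀)) (by nlinarith : 2 ≤ d * d)
  refine ⟨t ^ d / c₀, t, div_ne_zero (pow_ne_zero d ht) h₀, ht, div_mul_cancel₀ _ h₀, ?_⟩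
  rw [div_pow, eq_div_iff (pow_ne_zero d h₀), ← pow_mul, ← h]
  ring

theorem exists_scale_three {c₀ c₁ c₂ : ℂ} (h₀ : c₀ ≠ 0) (h₁ : c₁ ≠ 0) (h₂ : c₂ ≠ 0) {d : ℕ}
    (hd : 2 ≤ d) : ∃ s t u : ℂ, s ≠ 0 ∧ t ≠ 0 ∧ u ≠ 0 ∧
      s * c₀ = u ^ d ∧ t * c₁ = s ^ d ∧ u * c₂ = t ^ d := by
  obtain ⟨s, hs, h⟩ := exists_scale (c := c₀ * (c₁ ^ d * c₂) ^ d)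
    (mul_ne_zero h₀ (pow_ne_zero d (mul_ne_zero (pow_ne_zero d h₁) h₂)))
    (by nlinarith [Nat.mul_le_mul hd hd, Nat.mul_le_mul (Nat.mul_le_mul hd hd) hd] :
      2 ≤ d * d * d)
  have h12 : c₁ ^ d * c₂ ≠ 0 := mul_ne_zero (pow_ne_zero d h₁) h₂
  refine ⟨s, s ^ d / c₁, s ^ (d * d) / (c₁ ^ d * c₂), hs, div_ne_zero (pow_ne_zero d hs) h₁,
    div_ne_zero (pow_ne_zero _ hs) h12, ?_, div_mul_cancel₀ _ h₁, ?_⟩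
  · rw [div_pow, eq_div_iff (pow_ne_zero d h12), ← pow_mul, ← h]
    ring
  · rw [div_pow, ← pow_mul]
    field_simp

/-! ### Normal forms according to the permutation of the eigenvalues -/

namespace EquivariantLift

variable {F : Foliation} {φ : P2 → P2} {P : Fin 3 → Poly} {d : ℕ}
  {L : Matrix (Fin 3) (Fin 3) ℂ} {a b : ℂ} {M : GL (Fin 3) ℂ} {lam : Fin 3 → ℂ}

theorem exists_hasForm_irrational (H : EquivariantLift F φ P d L a b) (hM : Diagonalizes M L lam)
    (hlam : Function.Injective lam) (hσ : ∀ j, d * lam j = a * lam j + b) {r : ℂ}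
    (hr : r ∉ Set.range ((↑) : ℚ → ℂ)) (h : lam 1 - lam 2 = r * (lam 2 - lam 0)) :
    ∃ M' : GL (Fin 3) ℂ, HasForm F φ M' (dLog r 1 (-1 - r)) ![X 0 ^ d, X 1 ^ d, X 2 ^ d] := by
  have hc := fun j => H.exists_eq_C_mul_X_pow hM hlam (hσ j) (extremal_of_irrational hlam hr h j)
  choose c hc0 hc using hc
  choose s hs0 hs using fun j => exists_scale (hc0 j) H.two_le
  obtain ⟨hg, hB⟩ := dLog_eq_smul_cross hlam h
  refine ⟨_, H.hasForm_diagGL_mul hM hs0 hg hB fun v i => ?_⟩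
  rw [hc i, map_mul, map_pow, eval_C, eval_X, scale_pow (hs0 i) (hs i)]
  fin_cases i <;> simp

theorem exists_hasForm_cyclic (H : EquivariantLift F φ P d L a b) (hM : Diagonalizes M L lam)
    (hlam : Function.Injective lam) (hσ : ∀ j, d * lam j = a * lam (j + 1) + b) :
    ∃ (M' : GL (Fin 3) ℂ) (ξ : ℂ), IsPrimitiveRoot ξ 3 ∧
      HasForm F φ M' (dLog ξ 1 (-1 - ξ)) ![X 2 ^ d, X 0 ^ d, X 1 ^ d] := by
  have hd : (d : ℂ) ≠ 0 := by
    have := H.two_le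
    exact_mod_cast (by omega : d ≠ 0)
  have hδ : lam 2 - lam 0 ≠ 0 := sub_ne_zero.2 fun h => by simpa using hlam h
  have e0 : d * lam 0 = a * lam 1 + b := hσ 0
  have e1 : d * lam 1 = a * lam 2 + b := hσ 1
  have e2 : d * lam 2 = a * lam 0 + b := hσ 2
  obtain ⟨ξ, rfl⟩ : ∃ ξ, a = d * ξ := ⟨a / d, (mul_div_cancel₀ _ hd).symm⟩
  have h1 : lam 1 - lam 2 = ξ * (lam 2 - lam 0) := by
    apply mul_left_cancel₀ hd
    linear_combination e1 - e2
  have h0 : lam 0 - lam 1 = ξ * (lam 1 - lam 2) := by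
    apply mul_left_cancel₀ hd
    linear_combination e0 - e1
  -- Each consecutive difference of eigenvalues is `ξ` times the next, and the three differences sum
  -- to zero.
  have hξ : ξ ^ 2 + ξ + 1 = 0 := by
    apply mul_right_cancel₀ hδ
    linear_combination -h0 - (ξ + 1) * h1
  have hprim : IsPrimitiveRoot ξ 3 := by
    rw [← Polynomial.isRoot_cyclotomic_iff, Polynomial.cyclotomic_three, Polynomial.IsRoot]
    simpa using hξ
  have hirr : ξ ∉ Set.range ((↑) : ℚ → ℂ) := by
    rintro ⟨r, rfl⟩
    have : r ^ 2 + r + 1 = 0 := by exact_mod_cast hξ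
    nlinarith [sq_nonneg (r + 1 / 2)]
  have hext := extremal_of_irrational hlam hirr h1
  obtain ⟨c₀, hc₀, hP₀⟩ := H.exists_eq_C_mul_X_pow hM hlam e2 (hext 2)
  obtain ⟨c₁, hc₁, hP₁⟩ := H.exists_eq_C_mul_X_pow hM hlam e0 (hext 0)
  obtain ⟨c₂, hc₂, hP₂⟩ := H.exists_eq_C_mul_X_pow hM hlam e1 (hext 1)
  obtain ⟨s, t, u, hs, ht, hu, h₀, h₁, h₂⟩ := exists_scale_three hc₀ hc₁ hc₂ H.two_le
  obtain ⟨hg, hB⟩ := dLog_eq_smul_cross hlam h1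
  have hne : ∀ i, ![s, t, u] i ≠ 0 := by
    intro i; fin_cases i <;> assumption
  refine ⟨_, ξ, hprim, H.hasForm_diagGL_mul hM hne hg hB fun v i => ?_⟩
  fin_cases i
  · simpa [hP₀] using scale_pow hu h₀
  · simpa [hP₁] using scale_pow hs h₁
  · simpa [hP₂] using scale_pow ht h₂

/-- The last component, when `lam 2` is between `lam 0` and `lam 1`. -/
theorem exists_fibred_component (H : EquivariantLift F φ P d L a b) (hM : Diagonalizes M L lam)
    (hlam : Function.Injective lam) {p q : ℕ} {κ : ℂ} (hp : 0 < p) (hq : 0 < q)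
    (hpq : p.gcd q = 1) (hκ : κ ≠ 0) (h0 : lam 0 - lam 2 = q * κ)
    (h1 : lam 1 - lam 2 = -(p * κ)) (h2 : d * lam 2 = a * lam 2 + b) :
    ∃ (e : ℂ) (δ l : ℕ) (c : Fin l → ℂ), e ≠ 0 ∧ d = δ + l * (p + q) ∧ (∀ i, c i ≠ 0) ∧
      conj M P 2 = C e * fibredPoly p q δ c := by
  have hv := H.coeff_vertex_ne_zero hM hlam h2
  have hsupp : ∀ u, coeff u (conj M P 2) ≠ 0 → u 0 * q = u 1 * p := by
    intro u hu
    obtain ⟨w1, w2⟩ := H.weight hM hu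
    rw [Fin.sum_univ_three] at w1 w2
    have : ((u 0 * q : ℕ) : ℂ) = ((u 1 * p : ℕ) : ℂ) := by
      apply mul_right_cancel₀ hκ
      push_cast
      linear_combination w1 - h2 - lam 2 * w2 - (u 0 : ℂ) * h0 - (u 1 : ℂ) * h1
    exact_mod_cast this
  obtain ⟨δ, l, c, hdl, hc, hf⟩ := exists_eq_fibredPoly hp hq hpq
    (isHomogeneous_conj M H.homogeneous 2) hsupp hv
  exact ⟨_, δ, l, c, hv, hdl, hc, hf⟩

theorem scale_fibred {e : ℂ} {p q δ l : ℕ} {c : Fin l → ℂ} {s : Fin 3 → ℂ} (hs : ∀ i, s i ≠ 0)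
    (hdl : d = δ + l * (p + q)) (h : s 2 * e = s 2 ^ d) (hP : conj M P 2 = C e * fibredPoly p q δ c)
    (v : Fin 3 → ℂ) : s 2 * eval (fun j => (s j)⁻¹ * v j) (conj M P 2) =
      eval v (fibredPoly p q δ fun i =>
        c i * (s 2 ^ (p + q) * ((s 0)⁻¹ ^ p * (s 1)⁻¹ ^ q))) := by
  rw [hP, map_mul, eval_C, eval_fibredPoly_scale p q δ c hs, ← hdl, ← mul_assoc, h, ← mul_assoc,
    ← mul_pow, mul_inv_cancel₀ (hs 2), one_pow, one_mul]

theorem exists_hasForm_fibred (H : EquivariantLift F φ P d L a b) (hM : Diagonalizes M L lam)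
    (hlam : Function.Injective lam) {p q : ℕ} {κ : ℂ} (hp : 0 < p) (hq : 0 < q)
    (hpq : p.gcd q = 1) (hκ : κ ≠ 0) (h0 : lam 0 - lam 2 = q * κ)
    (h1 : lam 1 - lam 2 = -(p * κ)) (hσ : ∀ j, d * lam j = a * lam j + b) :
    ∃ (M' : GL (Fin 3) ℂ) (δ l : ℕ) (c : Fin l → ℂ), d = δ + l * (p + q) ∧ (∀ i, c i ≠ 0) ∧
      HasForm F φ M' (dQuot (X 0 ^ p * X 1 ^ q) (X 2 ^ (p + q)))
        ![X 0 ^ d, X 1 ^ d, fibredPoly p q δ c] := by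
  obtain ⟨e, δ, l, c, he, hdl, hc, hf⟩ :=
    H.exists_fibred_component hM hlam hp hq hpq hκ h0 h1 (hσ 2)
  obtain ⟨c₀, hc₀, hP₀⟩ := H.exists_eq_C_mul_X_pow hM hlam (hσ 0)
    (extremal_of_between hp hq hκ h0 h1 (by decide))
  obtain ⟨c₁, hc₁, hP₁⟩ := H.exists_eq_C_mul_X_pow hM hlam (hσ 1)
    (extremal_of_between hp hq hκ h0 h1 (by decide))
  obtain ⟨s, hs, es⟩ := exists_scale hc₀ H.two_le
  obtain ⟨t, ht, et⟩ := exists_scale hc₁ H.two_le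
  obtain ⟨u, hu, eu⟩ := exists_scale he H.two_le
  obtain ⟨hg, hB⟩ := dQuot_eq_smul_cross hp hq hκ h0 h1
  have hne : ∀ i, ![s, t, u] i ≠ 0 := by
    intro i; fin_cases i <;> assumption
  refine ⟨_, δ, l, fun i => c i * (u ^ (p + q) * (s⁻¹ ^ p * t⁻¹ ^ q)), hdl, fun i => mul_ne_zero (hc i) ?_,
    H.hasForm_diagGL_mul hM hne hg hB fun v i => ?_⟩
  · exact mul_ne_zero (pow_ne_zero _ hu)
      (mul_ne_zero (pow_ne_zero _ (inv_ne_zero hs)) (pow_ne_zero _ (inv_ne_zero ht)))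
  · fin_cases i
    · simpa [hP₀] using scale_pow hs es
    · simpa [hP₁] using scale_pow ht et
    · exact scale_fibred hne hdl eu hf v

/-- Subtracting the exchanged relations gives `a = -d`, which puts `lam 2` at the midpoint of `lam
0` and `lam 1`: the weights are those of `p = q = 1`. -/
theorem exists_hasForm_swap (H : EquivariantLift F φ P d L a b) (hM : Diagonalizes M L lam)
    (hlam : Function.Injective lam) (e0 : d * lam 0 = a * lam 1 + b)
    (e1 : d * lam 1 = a * lam 0 + b) (e2 : d * lam 2 = a * lam 2 + b) :
    ∃ (M' : GL (Fin 3) ℂ) (δ l : ℕ) (c : Fin l → ℂ), d = δ + 2 * l ∧ (∀ i, c i ≠ 0) ∧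
      HasForm F φ M' (dLog 1 1 (-2)) ![X 1 ^ d, X 0 ^ d, fibredPoly 1 1 δ c] := by
  have hd : (d : ℂ) ≠ 0 := by
    have := H.two_le
    exact_mod_cast (by omega : d ≠ 0)
  have h01 : lam 0 - lam 1 ≠ 0 := sub_ne_zero.2 fun h => by simpa using hlam h
  have ha : a = -d := by
    apply mul_right_cancel₀ h01
    linear_combination e0 - e1
  have hmid : lam 0 + lam 1 = 2 * lam 2 := by
    apply mul_left_cancel₀ hd
    linear_combination e0 - e2 + (lam 1 - lam 2) * ha
  have hκ : lam 0 - lam 2 ≠ 0 := sub_ne_zero.2 fun h => by simpa using hlam h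
  have k0 : lam 0 - lam 2 = (1 : ℕ) * (lam 0 - lam 2) := by simp
  have k1 : lam 1 - lam 2 = -((1 : ℕ) * (lam 0 - lam 2)) := by
    push_cast
    linear_combination hmid
  obtain ⟨e, δ, l, c, he, hdl, hc, hf⟩ :=
    H.exists_fibred_component hM hlam one_pos one_pos rfl hκ k0 k1 e2
  obtain ⟨c₀, hc₀, hP₀⟩ := H.exists_eq_C_mul_X_pow hM hlam e1
    (extremal_of_between one_pos one_pos hκ k0 k1 (by decide))
  obtain ⟨c₁, hc₁, hP₁⟩ := H.exists_eq_C_mul_X_pow hM hlam e0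
    (extremal_of_between one_pos one_pos hκ k0 k1 (by decide))
  obtain ⟨s, t, hs, ht, es, et⟩ := exists_scale_two hc₀ hc₁ H.two_le
  obtain ⟨u, hu, eu⟩ := exists_scale he H.two_le
  obtain ⟨hg, hB⟩ := dLog_eq_smul_cross hlam (r := 1) (by linear_combination hmid)
  rw [show (-1 - 1 : ℂ) = -2 by norm_num] at hB
  have hne : ∀ i, ![s, t, u] i ≠ 0 := by
    intro i; fin_cases i <;> assumption
  refine ⟨_, δ, l, fun i => c i * (u ^ (1 + 1) * (s⁻¹ ^ 1 * t⁻¹ ^ 1)), by omega, fun i => mul_ne_zero (hc i) ?_,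
    H.hasForm_diagGL_mul hM hne hg hB fun v i => ?_⟩
  · exact mul_ne_zero (pow_ne_zero _ hu)
      (mul_ne_zero (pow_ne_zero _ (inv_ne_zero hs)) (pow_ne_zero _ (inv_ne_zero ht)))
  · fin_cases i
    · simpa [hP₀] using scale_pow ht es
    · simpa [hP₁] using scale_pow hs et
    · exact scale_fibred hne hdl eu hf v

end EquivariantLift

/-! ### Ordering of the eigenvalues and cycle types -/

/-- Three distinct points, one of whose ratios is rational, can be ordered on a line with
commensurable distances. -/
theorem exists_perm_between {lam : Fin 3 → ℂ} (hlam : Function.Injective lam) {r : ℚ}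
    (h : lam 1 - lam 2 = r * (lam 2 - lam 0)) :
    ∃ (τ : Equiv.Perm (Fin 3)) (p q : ℕ) (κ : ℂ), 0 < p ∧ 0 < q ∧ p.gcd q = 1 ∧ κ ≠ 0 ∧
      lam (τ 0) - lam (τ 2) = q * κ ∧ lam (τ 1) - lam (τ 2) = -(p * κ) := by
  have hδ : lam 2 - lam 0 ≠ 0 := sub_ne_zero.2 fun h => by simpa using hlam h
  -- Affine coordinates of the eigenvalues on the line with origin `lam 0` and unit `lam 2`.
  let ρ : Fin 3 → ℚ := ![0, 1 + r, 1]
  have hρ : ∀ j, lam j = lam 0 + ρ j * (lam 2 - lam 0) := by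
    intro j
    fin_cases j
    · simp [ρ]
    · simp [ρ]
      linear_combination h
    · simp [ρ]
  have hinj : Function.Injective ρ := by
    intro i j hij
    apply hlam
    rw [hρ i, hρ j, hij]
  have hstrict : StrictMono (ρ ∘ Tuple.sort ρ) :=
    (Tuple.monotone_sort ρ).strictMono_of_injective (hinj.comp (Tuple.sort ρ).injective)
  obtain ⟨τ, h12, h20⟩ : ∃ τ : Equiv.Perm (Fin 3), ρ (τ 1) < ρ (τ 2) ∧ ρ (τ 2) < ρ (τ 0) := by
    -- The rotation gives the middle point the index `2`, the smallest `1` and the largest `0`.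
    let ε : Equiv.Perm (Fin 3) := (finRotate 3)⁻¹
    exact ⟨ε.trans (Tuple.sort ρ), hstrict (by decide : ε 1 < ε 2), hstrict (by decide : ε 2 < ε 0)⟩
  set x := ρ (τ 0) - ρ (τ 2) with hx
  set y := ρ (τ 2) - ρ (τ 1) with hy
  have hx0 : 0 < x := sub_pos.2 h20
  have hy0 : 0 < y := sub_pos.2 h12
  have hxy : 0 < x / y := div_pos hx0 hy0
  have hnum : 0 < (x / y).num := Rat.num_pos.2 hxy
  have hden : ((x / y).den : ℚ) ≠ 0 := by exact_mod_cast (x / y).den_nz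
  have hnat : (((x / y).num.natAbs : ℕ) : ℚ) = (x / y).num := by
    rw [← Int.cast_natCast, Int.natAbs_of_nonneg hnum.le]
  have hq : (((x / y).num.natAbs : ℕ) : ℚ) * (y / (x / y).den) = x := by
    rw [hnat]
    have h1 := Rat.num_div_den (x / y)
    calc ((x / y).num : ℚ) * (y / (x / y).den) = (x / y).num / (x / y).den * y := by ring
      _ = x := by rw [h1]; field_simp
  have hp : ((x / y).den : ℚ) * (y / (x / y).den) = y := by field_simp
  -- Writing the ratio of the two gaps in lowest terms as `q / p`, `κ` is their common measure `y /
  -- p = x / q`, scaled back to `ℂ`.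
  refine ⟨τ, (x / y).den, (x / y).num.natAbs, ((y / (x / y).den : ℚ) : ℂ) * (lam 2 - lam 0),
    (x / y).den_pos, by omega, ?_, ?_, ?_, ?_⟩
  · rw [Nat.gcd_comm]; exact (x / y).reduced
  · refine mul_ne_zero ?_ hδ
    exact_mod_cast (div_pos hy0 (by exact_mod_cast (x / y).den_pos)).ne'
  · have hq' : (((x / y).num.natAbs : ℕ) : ℂ) * ((y / (x / y).den : ℚ) : ℂ) = (x : ℂ) := by
      exact_mod_cast congrArg ((↑) : ℚ → ℂ) hq
    rw [← mul_assoc, hq', hρ (τ 0), hρ (τ 2), hx]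
    push_cast
    ring
  · have hp' : (((x / y).den : ℕ) : ℂ) * ((y / (x / y).den : ℚ) : ℂ) = (y : ℂ) := by
      exact_mod_cast congrArg ((↑) : ℚ → ℂ) hp
    rw [← mul_assoc, hp', hρ (τ 1), hρ (τ 2), hy]
    push_cast
    ring

/-- Cycle types up to conjugation: `τ` is the relabelling of the eigencoordinates that makes `σ` the
exchange of `0` and `1`, or the rotation. -/
theorem perm_fin_three_cases : ∀ σ : Equiv.Perm (Fin 3), σ = 1 ∨
    (∃ τ : Equiv.Perm (Fin 3), σ (τ 0) = τ 1 ∧ σ (τ 1) = τ 0 ∧ σ (τ 2) = τ 2) ∨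
    (∃ τ : Equiv.Perm (Fin 3), ∀ j, σ (τ j) = τ (j + 1)) := by
  decide

end FoliatedPlane

end

theorem theoremC (d : ℕ) (hd : 2 ≤ d) (φ : P2 → P2) (hφ : IsHolomorphicOfDegree φ d)
    (F : Foliation) (hF : Preserves φ F) :
    (HasDegree F 0 ∨ HasDegree F 1) ∧
    ∃ M : GL (Fin 3) ℂ,
      (∃ (P Q : MvPolynomial (Fin 2) ℂ) (R : Poly),
        P.IsHomogeneous d ∧ Q.IsHomogeneous d ∧ R.IsHomogeneous d ∧
        HasForm F φ M (dQuot (MvPolynomial.X 0) (MvPolynomial.X 1)) ![ofXY P, ofXY Q, R]) ∨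
      (∃ lam : ℂ, lam ∉ Set.range ((↑) : ℚ → ℂ) ∧
        HasForm F φ M (dLog lam 1 (-1 - lam))
          ![MvPolynomial.X 0 ^ d, MvPolynomial.X 1 ^ d, MvPolynomial.X 2 ^ d]) ∨
      (∃ ξ : ℂ, IsPrimitiveRoot ξ 3 ∧
        HasForm F φ M (dLog ξ 1 (-1 - ξ))
          ![MvPolynomial.X 2 ^ d, MvPolynomial.X 0 ^ d, MvPolynomial.X 1 ^ d]) ∨
      (∃ (p q δ l : ℕ) (c : Fin l → ℂ), 0 < p ∧ 0 < q ∧ p.gcd q = 1 ∧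
        d = δ + l * (p + q) ∧ (∀ i, c i ≠ 0) ∧
        HasForm F φ M
          (dQuot (MvPolynomial.X 0 ^ p * MvPolynomial.X 1 ^ q) (MvPolynomial.X 2 ^ (p + q)))
          ![MvPolynomial.X 0 ^ d, MvPolynomial.X 1 ^ d, fibredPoly p q δ c]) ∨
      (∃ (δ l : ℕ) (c : Fin l → ℂ), d = δ + 2 * l ∧ (∀ i, c i ≠ 0) ∧
        HasForm F φ M (dLog 1 1 (-2))
          ![MvPolynomial.X 1 ^ d, MvPolynomial.X 0 ^ d, fibredPoly 1 1 δ c]) := by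
  obtain ⟨d', P, hP, hφP, h, hh, hA⟩ := hF
  obtain ⟨Q, hQ, hφQ⟩ := hφ
  obtain rfl : d = d' := degree_eq_of_isGivenBy (by omega) hQ hP hφQ hφP
  have h0 := hφP.noCommonZero
  obtain ⟨hn, hJ⟩ := invariant_form_degree F hd hP h0 hh hA
  obtain ⟨V, hV, hform, hn0⟩ := exists_vectorField F
  rcases (by omega : F.n = 1 ∨ F.n = 2) with hn1 | hn2
  · have hVC : V = fun i => MvPolynomial.C (MvPolynomial.coeff 0 (V i)) := by
      funext i
      have := hV i
      rw [hn1, ← MvPolynomial.totalDegree_zero_iff_isHomogeneous,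
        MvPolynomial.totalDegree_eq_zero_iff_eq_C] at this
      exact this
    rw [hVC] at hform
    have hu : (fun i => MvPolynomial.coeff 0 (V i)) ≠ 0 := by
      intro hu
      apply form_ne_zero F
      rw [hform]
      have : (fun i => (MvPolynomial.C (MvPolynomial.coeff 0 (V i)) : Poly)) = 0 := by
        funext i
        rw [congrFun hu i]
        simp
      rw [this, map_zero]
    refine ⟨Or.inl (hasDegree_zero F hu hform), ?_⟩
    obtain ⟨M, R, S, T, hR, hS, hT, hM⟩ :=
      exists_hasForm_pencil F (by omega) hP hφP hA hu hform
    exact ⟨M, Or.inl ⟨R, S, T, hR, hS, hT, hM⟩⟩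
  · obtain ⟨k, hk, hJk⟩ := hJ hn2
    rw [hn2] at hV
    obtain ⟨L, rfl⟩ := exists_eq_linearForms hV
    refine ⟨Or.inr (hasDegree_one F hform), ?_⟩
    obtain ⟨a, b, ha, hE⟩ := exists_equivariance F hform (by omega) hP h0 hh hA hk hJk
    obtain ⟨M, lam, hlam, hM⟩ := exists_diagonalization
      (fun c v w hv0 hv hw => eigenvectors_proportional F hform hv0 hv hw)
      (semisimple_of_equivariance hd hP h0 ha hE)
    have H : EquivariantLift F φ P d L a b := ⟨hd, hP, hφP, hform, ha, hE⟩
    obtain ⟨σ, hσ⟩ := H.exists_perm hM hlam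
    rcases perm_fin_three_cases σ with rfl | ⟨τ, t0, t1, t2⟩ | ⟨τ, ht⟩
    · have hδ : lam 2 - lam 0 ≠ 0 := sub_ne_zero.2 fun h => by simpa using hlam h
      have hr : lam 1 - lam 2 = (lam 1 - lam 2) / (lam 2 - lam 0) * (lam 2 - lam 0) :=
        (div_mul_cancel₀ _ hδ).symm
      -- Every coordinate is fixed by `σ`; commensurable eigenvalue differences give the fibred map,
      -- and otherwise all components are pure powers.
      by_cases hrat : (lam 1 - lam 2) / (lam 2 - lam 0) ∈ Set.range ((↑) : ℚ → ℂ)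
      · obtain ⟨r, hr'⟩ := hrat
        rw [← hr'] at hr
        obtain ⟨τ, p, q, κ, hp, hq, hpq, hκ, e0, e1⟩ := exists_perm_between hlam hr
        obtain ⟨N, hN⟩ := hM.exists_comp_perm τ
        obtain ⟨M', δ, l, c, hdl, hc, hM'⟩ := H.exists_hasForm_fibred hN
          (hlam.comp τ.injective) hp hq hpq hκ e0 e1 (fun j => hσ (τ j))
        exact ⟨M', Or.inr (Or.inr (Or.inr (Or.inl
          ⟨p, q, δ, l, c, hp, hq, hpq, hdl, hc, hM'⟩)))⟩
      · obtain ⟨M', hM'⟩ := H.exists_hasForm_irrational hM hlam hσ hrat hr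
        exact ⟨M', Or.inr (Or.inl ⟨_, hrat, hM'⟩)⟩
    · obtain ⟨N, hN⟩ := hM.exists_comp_perm τ
      obtain ⟨M', δ, l, c, hdl, hc, hM'⟩ := H.exists_hasForm_swap hN (hlam.comp τ.injective)
        (by simpa [t0] using hσ (τ 0)) (by simpa [t1] using hσ (τ 1))
        (by simpa [t2] using hσ (τ 2))
      exact ⟨M', Or.inr (Or.inr (Or.inr (Or.inr ⟨δ, l, c, hdl, hc, hM'⟩)))⟩
    · obtain ⟨N, hN⟩ := hM.exists_comp_perm τ
      obtain ⟨M', ξ, hξ, hM'⟩ := H.exists_hasForm_cyclic hN (hlam.comp τ.injective)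
        (fun j => by simpa [ht] using hσ (τ j))
      exact ⟨M', Or.inr (Or.inr (Or.inl ⟨ξ, hξ, hM'⟩))⟩
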